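/- **Setting.** Let $R$ be a commutative ring with a chosen invertible element $q^{1/4}$ (for instance $R=\mathbb C(q^{1/4})$). For a lattice $L$ with a skew-symmetric integer form $B$, the quantum torus is the free $R$-module on symbols $e_\lambda$, $\lambda\in L$, with $e_\lambda e_\mu=q^{B(\lambda,\mu)/4}e_{\lambda+\mu}$; the $e_\lambda$ are its Weyl-ordered monomials, and $:\!M\!:$ denotes the Weyl-ordered form of a monomial $M$ in generators. Let $\Delta$ be an ideal triangulation (self-folded triangles allowed) of an oriented marked surface: a finite set of triangles with some pairs of sides glued, reversing orientation; unglued sides form the boundary. Its vertices are marked points (on the boundary) and punctures (interior). **Fencing graph.** Each triangle is a hexagon and each pair of glued sides is a rectangle, with alternating long and short edges. Long edges correspond to sides of triangles. Short edges lie around the vertices of $\Delta$ and are oriented clockwise around them. The vertices of the graph are the corners of the hexagons. Let $\widetilde\zeta_{SL_2}(\Delta)$ be the quantum torus on generators $A_\ell$ ($\ell$ long) and $a_e$ ($e$ short) with the relations: $a_eA_\ell=q^{1/2}A_\ell a_e$ if $e$ and $\ell$ meet; $a_ea_{e'}=q^{1/2}a_{e'}a_e$ if the head of $e$ is the tail of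 $e'$ and the tail of $e$ is not the head of $e'$; all other pairs of generators not related by these rules commute; and $a_1A_2=a_2A_1$ in each rectangle, where $a_1$ leads from $A_1$ to $A_2$ and $a_2$ from $A_2$ to $A_1$. It is graded by the fencing vertices: $A_\ell$ has weight $1$ at its two ends, and $a_e$ has weight $1$ at its tail and $-1$ at its head. Let $\widetilde\zeta_{PGL_2}(\Delta)$ be the subalgebra generated by all $A_\ell^{\pm2}$, all $a_e^{\pm2}$, and $(A_{\ell_1}A_{\ell_2}A_{\ell_3}a_1a_2a_3)^{\pm1}$ for each hexagon. **Notched triangulation $\Delta_\bullet$.** Choose an angle of a triangle at each puncture (the notch); the distinguished fencing vertex there is the head of the short edge in that angle. At a marked point the distinguished fencing vertex is the clockwise first one. The edge-ends at each vertex of $\Delta$ are ordered clockwise from the distinguished fencing vertex. Let $\zeta_{SL_2}(\Delta_\bullet)\subset\widetilde\zeta_{SL_2}(\Delta)$ be the subalgebra of elements of weight $0$ at all non-distinguished fencing vertices, $\zeta_{PGL_2}(\Delta_\bullet)=\widetilde\zeta_{PGL_2}(\Delta)\cap\zeta_{SL_2}(\Delta_\bullet)$, and let $\chi_{PGL_2}(\Delta)\subset\zeta_{PGL_2}(\Delta_\bullet)$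 be the subalgebra of elements that also have weight $0$ at the distinguished fencing vertices of the punctures. For an edge $s$ of $\Delta$ let $Z_s$ be the Weyl-ordered product of $A_\ell$, for a long edge $\ell$ on $s$, and of the $a_e$ along the minimal clockwise paths from the distinguished fencing vertices to the two ends of $\ell$. For a puncture $p$ let $\alpha_p$ be the Weyl-ordered product of all $a_e$ around $p$. **The elements $\widetilde X_s$ and $\alpha_s$.** Let $s$ have edge-ends $s_1,s_2$ at $v_1,v_2$, and let $Z_{s_i^{\pm}}$ be the variable of the edge whose end follows ($+$) or precedes ($-$) $s_i$ clockwise at $v_i$. * If $s$ is neither a boundary edge nor the internal edge of a self-folded triangle, $\widetilde X_s=\;:\!Z_{s_1^-}Z_{s_1^+}^{-1}Z_{s_2^-}Z_{s_2^+}^{-1}\!:$. * If $s$ is a boundary edge, running from $v_1$ to $v_2$ in the counterclockwise direction (surface on the left), $\widetilde X_s=\;:\!Z_sZ_{s_1^-}Z_{s_2^+}^{-1}\!:$. * If $s$ is the internal edge of a self-folded triangle with outer edge $s'$, $\widetilde X_s=\widetilde X_{s'}$. For a puncture $p$ let $\epsilon_p(s)=1$ if an end of $s$ is the first or the last edge-end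 at $p$; $\epsilon_p(s)=-1$ if $s$ is the side opposite to the notch of $p$ in the triangle that has the notch of $p$ as one of its angles (and the first case does not apply); and $\epsilon_p(s)=0$ otherwise. Put $\alpha_s=\prod_p\alpha_p^{\epsilon_p(s)}$ if $s$ is not the internal edge of a self-folded triangle, and $\alpha_s=\alpha_{s'}\alpha_p^2$ if $s$ is the internal edge of a self-folded triangle with outer edge $s'$ and internal puncture $p$. **The quantum $\mathcal X$-torus.** Let $\mathcal X^q_\Delta$ be the quantum torus on generators $X_s$, for all edges $s$ of $\Delta$ (boundary edges included), with $X_sX_t=q^{2\varepsilon_{st}}X_tX_s$. Here $\varepsilon_{st}$ is the number of occurrences of $t$ immediately following $s$ clockwise along the boundary of a triangle that is not self-folded, minus the number of occurrences of $s$ immediately following $t$; the internal edge of a self-folded triangle is replaced by the outer edge in this count. **Theorem.** There is a unique homomorphism of $R$-algebras $$\iota_{\Delta_\bullet}\colon\mathcal X^q_\Delta\longrightarrow\zeta_{SL_2}(\Delta_\bullet),\qquad X_s\longmapsto\;:\!\widetilde X_s\alpha_s\!:\quad\text{for all edges } s,$$ and it restricts to an isomorphism of $R$-algebras from $\mathcal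 X^q_\Delta$ onto the subalgebra $\chi_{PGL_2}(\Delta)$. -/

import Mathlib

noncomputable section

/-! ### Quantum tori -/

/-- The quantum torus of a lattice `L` with a skew-symmetric integer form `B`, over a commutative
ring `R` in which an invertible element `v` is fixed: the free `R`-module on the symbols `e_l`,
`l ∈ L`, with the product `e_l * e_m = v ^ B(l, m) e_{l + m}`.  Hence
`e_l * e_m = v ^ (2 * B(l, m)) e_m * e_l`, and the `e_l` are the Weyl-ordered monomials.
Throughout, `v` plays the role of `q ^ (1/4)`. -/
def QuantumTorus (R : Type*) [CommRing R] (_v : Rˣ) {L : Type*} [AddCommGroup L]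
    (_B : L →ₗ[ℤ] L →ₗ[ℤ] ℤ) : Type _ :=
  L →₀ R

namespace QuantumTorus

variable {R : Type*} [CommRing R] {v : Rˣ} {L : Type*} [AddCommGroup L]
  {B : L →ₗ[ℤ] L →ₗ[ℤ] ℤ}

instance : AddCommGroup (QuantumTorus R v B) := inferInstanceAs (AddCommGroup (L →₀ R))

instance : Module R (QuantumTorus R v B) := inferInstanceAs (Module R (L →₀ R))

/-- The Weyl-ordered monomial `e_l` with exponent `l`. -/
def weyl (R : Type*) [CommRing R] (v : Rˣ) {L : Type*} [AddCommGroup L]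
    (B : L →ₗ[ℤ] L →ₗ[ℤ] ℤ) (l : L) : QuantumTorus R v B :=
  Finsupp.single l (1 : R)

/-- The set of exponents that occur in an element. -/
def support (x : QuantumTorus R v B) : Finset L :=
  Finsupp.support (show L →₀ R from x)

/-- The multiplication, as the bilinear map with `(e_l, e_m) ↦ v ^ B(l, m) e_{l + m}`. -/
def mulMap (R : Type*) [CommRing R] (v : Rˣ) {L : Type*} [AddCommGroup L]
    (B : L →ₗ[ℤ] L →ₗ[ℤ] ℤ) :
    QuantumTorus R v B →ₗ[R] QuantumTorus R v B →ₗ[R] QuantumTorus R v B :=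
  Finsupp.linearCombination R fun l : L =>
    (Finsupp.linearCombination R fun m : L => ((v ^ B l m : Rˣ) : R) • weyl R v B (l + m) :
      (L →₀ R) →ₗ[R] QuantumTorus R v B)

theorem mulMap_weyl (l m : L) :
    mulMap R v B (weyl R v B l) (weyl R v B m) =
      ((v ^ B l m : Rˣ) : R) • weyl R v B (l + m) := by
  unfold mulMap
  conv_lhs => unfold weyl
  erw [Finsupp.linearCombination_single, one_smul, Finsupp.linearCombination_single, one_smul]
  rfl

theorem induction {P : QuantumTorus R v B → Prop} (x : QuantumTorus R v B)
    (zero : P 0) (add : ∀ x y, P x → P y → P (x + y))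
    (weyl : ∀ (c : R) (l : L), P (c • weyl R v B l)) : P x := by
  refine Finsupp.induction_linear (motive := P) x zero add fun l c => ?_
  have h := weyl c l
  have e : c • QuantumTorus.weyl R v B l = (Finsupp.single l c : L →₀ R) := by
    unfold QuantumTorus.weyl
    erw [Finsupp.smul_single]
    simp
    rfl
  rwa [e] at h

instance : Mul (QuantumTorus R v B) := ⟨fun x y => mulMap R v B x y⟩

instance : One (QuantumTorus R v B) := ⟨weyl R v B 0⟩

theorem mul_def (x y : QuantumTorus R v B) : x * y = mulMap R v B x y := rfl

theorem one_def : (1 : QuantumTorus R v B) = weyl R v B 0 := rfl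

theorem weyl_mul_weyl (l m : L) :
    weyl R v B l * weyl R v B m = ((v ^ B l m : Rˣ) : R) • weyl R v B (l + m) :=
  mulMap_weyl l m

instance : Ring (QuantumTorus R v B) :=
  { (inferInstance : AddCommGroup (QuantumTorus R v B)) with
    mul := (· * ·)
    one := 1
    left_distrib := fun x y z => by simp only [mul_def, map_add]
    right_distrib := fun x y z => by simp only [mul_def, map_add, LinearMap.add_apply]
    zero_mul := fun x => by simp only [mul_def, map_zero, LinearMap.zero_apply]
    mul_zero := fun x => by simp only [mul_def, map_zero]
    one_mul := fun x => by
      refine induction (P := fun x => 1 * x = x) x ?_ ?_ ?_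
      · simp only [mul_def, map_zero]
      · intro x y hx hy
        simp only [mul_def, map_add] at *
        rw [hx, hy]
      · intro c l
        simp only [mul_def, map_smul, one_def, mulMap_weyl]
        simp
    mul_one := fun x => by
      refine induction (P := fun x => x * 1 = x) x ?_ ?_ ?_
      · simp only [mul_def, map_zero, LinearMap.zero_apply]
      · intro x y hx hy
        simp only [mul_def, map_add, LinearMap.add_apply] at *
        rw [hx, hy]
      · intro c l
        simp only [mul_def, map_smul, LinearMap.smul_apply, one_def, mulMap_weyl]
        simp
    mul_assoc := fun x y z => by
      refine induction (P := fun x => x * y * z = x * (y * z)) x ?_ ?_ ?_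
      · simp only [mul_def, map_zero, LinearMap.zero_apply]
      · intro x x' hx hx'
        simp only [mul_def, map_add, LinearMap.add_apply] at *
        rw [hx, hx']
      · intro c l
        refine induction
          (P := fun y => c • weyl R v B l * y * z = c • weyl R v B l * (y * z)) y ?_ ?_ ?_
        · simp only [mul_def, map_zero, LinearMap.zero_apply]
        · intro y y' hy hy'
          simp only [mul_def, map_add, LinearMap.add_apply] at *
          rw [hy, hy']
        · intro d m
          refine induction
            (P := fun z => c • weyl R v B l * d • weyl R v B m * z =
              c • weyl R v B l * (d • weyl R v B m * z)) z ?_ ?_ ?_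
          · simp only [mul_def, map_zero]
          · intro z z' hz hz'
            simp only [mul_def, map_add] at *
            rw [hz, hz']
          · intro f n
            simp only [mul_def, map_smul, LinearMap.smul_apply, mulMap_weyl, smul_smul, map_add,
              LinearMap.add_apply, add_assoc, zpow_add, Units.val_mul]
            congr 1
            ring }

instance : Algebra R (QuantumTorus R v B) :=
  Algebra.ofModule
    (fun c x y => by simp only [mul_def, map_smul, LinearMap.smul_apply])
    (fun c x y => by simp only [mul_def, map_smul])

theorem eq_sum (x : QuantumTorus R v B) :
    x = ∑ l ∈ x.support, (show L →₀ R from x) l • weyl R v B l := by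
  conv_lhs => rw [← Finsupp.sum_single (show L →₀ R from x)]
  refine Finset.sum_congr rfl fun l _ => ?_
  unfold weyl
  erw [Finsupp.smul_single]
  simp
  rfl

/-- The subalgebra of the elements which, for every `i ∈ S`, are invariant under the torus whose
weights are given by `wt i`, that is, which are homogeneous of weight zero. -/
def invariants (R : Type*) [CommRing R] (v : Rˣ) {L : Type*} [AddCommGroup L]
    (B : L →ₗ[ℤ] L →ₗ[ℤ] ℤ) {I : Type*} (wt : I → L →ₗ[ℤ] ℤ) (S : Set I) :
    Subalgebra R (QuantumTorus R v B) where
  carrier := {x | ∀ l ∈ x.support, ∀ i ∈ S, wt i l = 0}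
  algebraMap_mem' c := by
    intro l hl i _
    have h : algebraMap R (QuantumTorus R v B) c = c • weyl R v B 0 := Algebra.algebraMap_eq_smul_one c
    rw [h] at hl
    have h2 : l ∈ (Finsupp.single (0 : L) (1 : R)).support := Finsupp.support_smul hl
    have h3 := Finsupp.support_single_subset h2
    rw [Finset.mem_singleton] at h3
    rw [h3, map_zero]
  add_mem' {x y} hx hy := by
    classical
    intro l hl i hi
    have h : l ∈ x.support ∪ y.support := Finsupp.support_add hl
    rcases Finset.mem_union.1 h with h | h
    · exact hx l h i hi
    · exact hy l h i hi
  mul_mem' {x y} hx hy := by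
    let M : Submodule R (QuantumTorus R v B) :=
      Finsupp.supported R R {l : L | ∀ i ∈ S, wt i l = 0}
    have hM : ∀ z : QuantumTorus R v B, z ∈ M ↔ ∀ l ∈ z.support, ∀ i ∈ S, wt i l = 0 :=
      fun z => Finsupp.mem_supported R (show L →₀ R from z)
    refine (hM _).1 ?_
    rw [eq_sum x, eq_sum y, Finset.sum_mul]
    refine Submodule.sum_mem _ fun l hl => ?_
    rw [Finset.mul_sum]
    refine Submodule.sum_mem _ fun m hm => ?_
    rw [smul_mul_smul_comm, weyl_mul_weyl]
    refine Submodule.smul_mem _ _ (Submodule.smul_mem _ _ ?_)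
    refine Finsupp.single_mem_supported R 1 ?_
    intro i hi
    rw [map_add, hx l hl i hi, hy m hm i hi, add_zero]

/-- The bilinear form on the free lattice `G →₀ ℤ` with the prescribed values on the basis. -/
def formOf {G : Type*} (f : G → G → ℤ) : (G →₀ ℤ) →ₗ[ℤ] (G →₀ ℤ) →ₗ[ℤ] ℤ :=
  Finsupp.linearCombination ℤ fun g => Finsupp.linearCombination ℤ fun h => f g h

end QuantumTorus

/-! ### Ideal triangulations -/

/-- An ideal triangulation of an oriented marked surface, given by a set `F` of triangles and the
gluing of their sides.  The triangle `f` has three sides `(f, i)`, `i ∈ ℤ/3`, in counterclockwise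
order, and each side is oriented counterclockwise.  The involution `glue` pairs the sides that are
glued to each other (reversing their orientations); the sides that it fixes are not glued and form
the boundary.  The vertices are the marked points (on the boundary) and the punctures (inside). -/
structure IdealTriangulation (F : Type*) where
  glue : F × ZMod 3 → F × ZMod 3
  glue_glue : ∀ s, glue (glue s) = s

namespace IdealTriangulation

/-- The sides of the triangles. -/
abbrev Side (F : Type*) : Type _ := F × ZMod 3

/-- The counterclockwise next side of the same triangle. -/
def next {F : Type*} (s : Side F) : Side F := (s.1, s.2 + 1)

/-- The counterclockwise previous side of the same triangle. -/
def prev {F : Type*} (s : Side F) : Side F := (s.1, s.2 - 1)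

theorem next_prev {F : Type*} (s : Side F) : next (prev s) = s := by
  simp [next, prev]

theorem prev_next {F : Type*} (s : Side F) : prev (next s) = s := by
  simp [next, prev]

theorem next_next {F : Type*} (s : Side F) : next (next s) = prev s := by
  obtain ⟨f, i⟩ := s
  simp only [next, prev, Prod.mk.injEq, true_and]
  revert i
  decide

theorem prev_prev {F : Type*} (s : Side F) : prev (prev s) = next s := by
  obtain ⟨f, i⟩ := s
  simp only [next, prev, Prod.mk.injEq, true_and]
  revert i
  decide

theorem next_ne {F : Type*} (s : Side F) : next s ≠ s := by
  obtain ⟨f, i⟩ := s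
  simp only [next, ne_eq, Prod.mk.injEq, true_and]
  revert i
  decide

theorem prev_ne {F : Type*} (s : Side F) : prev s ≠ s := by
  obtain ⟨f, i⟩ := s
  simp only [prev, ne_eq, Prod.mk.injEq, true_and]
  revert i
  decide

/-! ### The fencing graph

Every triangle is a hexagon with alternating long and short edges, and every pair of glued sides is
a rectangle (digon) with alternating long and short edges.  The long edges are in bijection with
the sides.  The vertices are the corners of the hexagons; each is an endpoint of exactly one long
edge. -/

/-- The vertices of the fencing graph: `(s, false)` and `(s, true)` are the starting point and the
end point of the long edge `s`. -/
abbrev Vertex (F : Type*) : Type _ := Side F × Bool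

/-- The starting point of the long edge `s`. -/
abbrev src {F : Type*} (s : Side F) : Vertex F := (s, false)

/-- The end point of the long edge `s`. -/
abbrev tgt {F : Type*} (s : Side F) : Vertex F := (s, true)

variable {F : Type*} (T : IdealTriangulation F)

/-- The short edges of the fencing graph.  `hex s` is the short edge of the hexagon at the corner
where the side `s` starts; `dig s` is the short edge of the rectangle of an interior side `s` which
lies at the start of `s`. -/
inductive ShortEdge : Type _ where
  | hex (s : Side F) : ShortEdge
  | dig (s : Side F) (h : T.glue s ≠ s) : ShortEdge

variable {T}

/-- The tail of a short edge, for the clockwise orientation around the vertex. -/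
def ShortEdge.tail : T.ShortEdge → Vertex F
  | .hex s => tgt (prev s)
  | .dig s _ => src s

/-- The head of a short edge, for the clockwise orientation around the vertex. -/
def ShortEdge.head : T.ShortEdge → Vertex F
  | .hex s => src s
  | .dig s _ => tgt (T.glue s)

variable (T)

/-- The generators of the fencing graph torus: the long edges and the short edges. -/
inductive Gen : Type _ where
  | long (s : Side F) : Gen
  | short (e : T.ShortEdge) : Gen

variable {T}

/-- The long edge `s` and the short edge `e` have a common vertex. -/
def Meets (s : Side F) (e : T.ShortEdge) : Prop :=
  e.tail = src s ∨ e.tail = tgt s ∨ e.head = src s ∨ e.head = tgt s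

open Classical in
/-- The commutation exponents: `x * y = q ^ (fencingExp x y / 2) y * x` for generators. -/
def fencingExp : T.Gen → T.Gen → ℤ
  | .long _, .long _ => 0
  | .short e, .long s => if Meets s e then 1 else 0
  | .long s, .short e => if Meets s e then -1 else 0
  | .short e, .short e' =>
    if e.head = e'.tail ∧ e.tail ≠ e'.head then 1
    else if e'.head = e.tail ∧ e'.tail ≠ e.head then -1
    else 0

open Classical in
/-- The weight of a generator for the torus at the vertex `w` of the fencing graph. -/
def genWeight (w : Vertex F) : T.Gen → ℤ
  | .long s => if w = src s ∨ w = tgt s then 1 else 0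
  | .short e => if w = e.tail then 1 else if w = e.head then -1 else 0

variable (T)

/-- The relations between exponents that express `a₁ A₂ = a₂ A₁` in each rectangle, where `a₁`
leads from the long edge `A₁` to the long edge `A₂`, and `a₂` leads back. -/
def digonRelations : Set (T.Gen →₀ ℤ) :=
  {r | ∃ (s : Side F) (h : T.glue s ≠ s) (h' : T.glue (T.glue s) ≠ T.glue s),
    r = (Finsupp.single (.short (.dig s h)) 1 + Finsupp.single (.long (T.glue s)) 1) -
      (Finsupp.single (.short (.dig (T.glue s) h')) 1 + Finsupp.single (.long s) 1)}

/-- The lattice of exponents of the fencing graph torus. -/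
abbrev Lattice : Type _ := (T.Gen →₀ ℤ) ⧸ Submodule.span ℤ T.digonRelations

theorem fencingExp_neg (x y : T.Gen) : fencingExp x y = -fencingExp y x := by
  cases x <;> cases y <;> simp only [fencingExp] <;> (try split_ifs) <;> grind

theorem fencingExp_relation (s : Side F) (h : T.glue s ≠ s)
    (h' : T.glue (T.glue s) ≠ T.glue s) (g : T.Gen) :
    fencingExp (.short (.dig s h)) g + fencingExp (.long (T.glue s)) g =
      fencingExp (.short (.dig (T.glue s) h')) g + fencingExp (.long s) g := by
  have h1 := T.glue_glue s
  rcases g with r | (r | ⟨r, hr⟩)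
  · simp only [fencingExp, Meets, ShortEdge.tail, ShortEdge.head, Prod.mk.injEq, h1]
    split_ifs <;> grind
  · have e1 := next_prev r
    have e2 := prev_ne r
    simp only [fencingExp, Meets, ShortEdge.tail, ShortEdge.head, Prod.mk.injEq, h1]
    split_ifs <;> grind
  · have h2 := T.glue_glue r
    simp only [fencingExp, Meets, ShortEdge.tail, ShortEdge.head, Prod.mk.injEq, h1]
    split_ifs <;> grind

theorem genWeight_relation (w : Vertex F) (s : Side F) (h : T.glue s ≠ s)
    (h' : T.glue (T.glue s) ≠ T.glue s) :
    genWeight w (.short (.dig s h)) + genWeight (T := T) w (.long (T.glue s)) =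
      genWeight w (.short (.dig (T.glue s) h')) + genWeight (T := T) w (.long s) := by
  have h1 := T.glue_glue s
  rcases w with ⟨r, b⟩
  simp only [genWeight, ShortEdge.tail, ShortEdge.head, Prod.mk.injEq, h1]
  cases b <;> split_ifs <;> grind

/-- The skew-symmetric form on the lattice of exponents that is given by the commutation exponents
of the generators. -/
def form : T.Lattice →ₗ[ℤ] T.Lattice →ₗ[ℤ] ℤ :=
  LinearMap.liftQ₂ (Submodule.span ℤ T.digonRelations) (Submodule.span ℤ T.digonRelations)
    (QuantumTorus.formOf (fencingExp (T := T)))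
    (by
      rw [Submodule.span_le]
      rintro r ⟨s, h, h', rfl⟩
      rw [SetLike.mem_coe, LinearMap.mem_ker]
      refine Finsupp.lhom_ext' fun g => LinearMap.ext_ring ?_
      have := fencingExp_relation T s h h' g
      simp [QuantumTorus.formOf]
      linarith)
    (by
      rw [Submodule.span_le]
      rintro r ⟨s, h, h', rfl⟩
      rw [SetLike.mem_coe, LinearMap.mem_ker]
      refine Finsupp.lhom_ext' fun g => LinearMap.ext_ring ?_
      have := fencingExp_relation T s h h' g
      rw [fencingExp_neg T _ g, fencingExp_neg T _ g, fencingExp_neg T _ g,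
        fencingExp_neg T _ g] at this
      simp [QuantumTorus.formOf]
      linarith)

/-- The weight of an exponent for the torus at the vertex `w` of the fencing graph. -/
def weight (w : Vertex F) : T.Lattice →ₗ[ℤ] ℤ :=
  (Submodule.span ℤ T.digonRelations).liftQ
    (Finsupp.linearCombination ℤ (genWeight (T := T) w))
    (by
      rw [Submodule.span_le]
      rintro r ⟨s, h, h', rfl⟩
      rw [SetLike.mem_coe, LinearMap.mem_ker]
      have := genWeight_relation T w s h h'
      simp
      linarith)

/-- The exponent of the generator that belongs to a long edge. -/
def longVec (s : Side F) : T.Lattice :=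
  Submodule.Quotient.mk (Finsupp.single (.long s) 1)

/-- The exponent of the generator that belongs to a short edge. -/
def shortVec (e : T.ShortEdge) : T.Lattice :=
  Submodule.Quotient.mk (Finsupp.single (.short e) 1)

/-- The fencing graph torus: the quantum torus on generators `A_s` for the long edges and `a_e` for
the short edges of the fencing graph, with the relations (where `q ^ (1/4) = v`)
`a_e A_s = q ^ (1/2) A_s a_e` if `e` and `s` meet, `a_e a_e' = q ^ (1/2) a_e' a_e` if the head of
`e` is the tail of `e'` but not conversely, all other pairs commute, and `a₁ A₂ = a₂ A₁` in every
rectangle. -/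
abbrev FencingTorus (R : Type*) [CommRing R] (v : Rˣ) : Type _ :=
  QuantumTorus R v T.form

/-- The subalgebra of invariants of the fencing graph torus for the tori at the vertices in `S`. -/
def gateInvariants (R : Type*) [CommRing R] (v : Rˣ) (S : Set (Vertex F)) :
    Subalgebra R (T.FencingTorus R v) :=
  QuantumTorus.invariants R v T.form T.weight S

/-- The exponent of the product of the six edges of the hexagon `f`. -/
def hexagonVec (f : F) : T.Lattice :=
  ∑ i : ZMod 3, (T.longVec (f, i) + T.shortVec (.hex (f, i)))

/-- The fencing graph torus for `PGL₂`: the subalgebra generated by the even powers of the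
generators and by the products, and their inverses, of the six edges of a hexagon. -/
def fencingPGL2 (R : Type*) [CommRing R] (v : Rˣ) : Subalgebra R (T.FencingTorus R v) :=
  Algebra.adjoin R
    ({x | ∃ (s : Side F) (n : ℤ), (n = 2 ∨ n = -2) ∧
        x = QuantumTorus.weyl R v T.form (n • T.longVec s)} ∪
      {x | ∃ (e : T.ShortEdge) (n : ℤ), (n = 2 ∨ n = -2) ∧
        x = QuantumTorus.weyl R v T.form (n • T.shortVec e)} ∪
      {x | ∃ (f : F) (n : ℤ), (n = 1 ∨ n = -1) ∧
        x = QuantumTorus.weyl R v T.form (n • T.hexagonVec f)})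

/-! ### Vertices, edges and notchings -/

/-- The `T`-regions, that is, the vertices of the ideal triangulation: the classes of vertices of
the fencing graph that are connected by short edges. -/
def Region : Type _ :=
  Quot fun u w : Vertex F => ∃ e : T.ShortEdge, e.tail = u ∧ e.head = w

/-- The region that contains a vertex of the fencing graph. -/
def region (w : Vertex F) : T.Region := Quot.mk _ w

/-- A region is a marked point if a boundary side ends in it; otherwise it is a puncture. -/
def IsMarked (r : T.Region) : Prop :=
  ∃ w : Vertex F, T.glue w.1 = w.1 ∧ T.region w = r

/-- The punctures. -/
def Puncture : Type _ := {r : T.Region // ¬ T.IsMarked r}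

instance [Finite F] : Finite T.Region :=
  inferInstanceAs (Finite (Quot _))

instance [Finite F] : Finite T.Puncture :=
  inferInstanceAs (Finite {r : T.Region // ¬ T.IsMarked r})

instance [Finite F] : Fintype T.Puncture := Fintype.ofFinite _

/-- The edges of the ideal triangulation: the sides of the triangles, up to gluing. -/
def Edge : Type _ := Quot fun s t : Side F => t = T.glue s

/-- The edge that contains a side. -/
def edge (s : Side F) : T.Edge := Quot.mk _ s

/-- A notching: a distinguished vertex of the fencing graph in each region.  At a puncture this is
the head of a short edge of a hexagon, that is, an angle of a triangle is distinguished; at a marked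
point it is the first vertex in the clockwise order. -/
structure Notching where
  base : T.Region → Vertex F
  region_base : ∀ r, T.region (base r) = r
  base_puncture : ∀ r, ¬ T.IsMarked r → ∃ s, base r = src s
  base_marked : ∀ r, T.IsMarked r → ∃ s, T.glue s = s ∧ base r = tgt s

open Classical in
/-- The clockwise next vertex of the fencing graph in the same region (or the same vertex, if it is
the last one at a marked point). -/
def step : Vertex F → Vertex F
  | (s, true) => src (next s)
  | (s, false) => if T.glue s = s then src s else tgt (T.glue s)

open Classical in
/-- The exponent of the short edge whose tail is the given vertex (zero if there is none). -/
def outVec : Vertex F → T.Lattice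
  | (s, true) => T.shortVec (.hex (next s))
  | (s, false) => if h : T.glue s = s then 0 else T.shortVec (.dig s h)

/-- The exponent of the product of the short edges on the minimal clockwise path from `u` to `w`,
for two vertices of the same region. -/
def pathVec (u w : Vertex F) : T.Lattice :=
  ∑ i ∈ Finset.range (sInf {n : ℕ | T.step^[n] u = w}), T.outVec (T.step^[i] u)

open Classical in
/-- The exponent of `α_p`, the Weyl-ordered product of all of the short edges around a puncture. -/
def alphaVec [Fintype F] (p : T.Region) : T.Lattice :=
  ∑ w : Vertex F, if T.region w = p then T.outVec w else 0

/-! ### Self-folded triangles and the quantum `X`-torus -/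

/-- The side is one of the two sides of the internal edge of a self-folded triangle. -/
def IsInner (s : Side F) : Prop := T.glue s = next s ∨ T.glue s = prev s

open Classical in
/-- For a side of the internal edge of a self-folded triangle, the outer side of that triangle; any
other side is left unchanged. -/
def outer (s : Side F) : Side F :=
  if T.glue s = next s then prev s else if T.glue s = prev s then next s else s

open Classical in
/-- The internal puncture of a self-folded triangle, given a side `s` of its internal edge. -/
def innerRegion (s : Side F) : T.Region :=
  if T.glue s = next s then T.region (tgt s) else T.region (src s)

/-- The map on edges that replaces the internal edge of a self-folded triangle by the outer one. -/
def outerEdge : T.Edge → T.Edge :=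
  Quot.lift (fun s => T.edge (T.outer s)) (by
    rintro s t rfl
    have key : T.outer (T.glue s) = T.outer s ∨ T.outer (T.glue s) = T.glue (T.outer s) := by
      have h1 := T.glue_glue s
      have h2 := next_prev s
      have h3 := prev_next s
      have h4 := next_next s
      have h5 := prev_prev s
      have h6 := next_ne s
      have h7 := prev_ne s
      have h8 := next_prev (T.glue s)
      have h9 := prev_next (T.glue s)
      have h10 := next_next (T.glue s)
      have h11 := prev_prev (T.glue s)
      unfold outer
      rw [h1]
      split_ifs <;> grind
    rcases key with h | h
    · show T.edge (T.outer s) = T.edge (T.outer (T.glue s))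
      rw [h]
    · show T.edge (T.outer s) = T.edge (T.outer (T.glue s))
      rw [h]
      exact Quot.sound rfl)

open Classical in
/-- The exchange matrix of the ideal triangulation, on all edges (boundary edges are the frozen
ones): the number of angles of triangles at which `t` follows `s` clockwise along the boundary of
the triangle, minus the number of those at which `s` follows `t`.  Only the triangles that are not
self-folded count, and the internal edge of a self-folded triangle is treated as the outer one. -/
def exchange [Fintype F] (s t : T.Edge) : ℤ :=
  ∑ r : Side F,
    if ∃ i : ZMod 3, T.IsInner (r.1, i) then 0
    else (if T.edge r = T.outerEdge s ∧ T.edge (prev r) = T.outerEdge t then 1 else 0) -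
      (if T.edge r = T.outerEdge t ∧ T.edge (prev r) = T.outerEdge s then 1 else 0)

/-- The quantum cluster chart `X^q` of the triangulation: the quantum torus on generators `X_s`, for
all edges `s`, with `X_s X_t = q ^ (2 ε(s, t)) X_t X_s`, where `ε` is the exchange matrix and
`v = q ^ (1/4)`. -/
abbrev XTorus [Fintype F] (R : Type*) [CommRing R] (v : Rˣ) : Type _ :=
  QuantumTorus R v (QuantumTorus.formOf fun s t : T.Edge => 4 * T.exchange s t)

/-- The quantum cluster `X`-variable of an edge. -/
def clusterX [Fintype F] (R : Type*) [CommRing R] (v : Rˣ) (s : T.Edge) : T.XTorus R v :=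
  QuantumTorus.weyl R v _ (Finsupp.single s 1)

/-! ### The tori of a notched triangulation -/

namespace Notching

variable {T} (N : T.Notching)

/-- The algebra `ζ_{SL₂}`: all gates but the distinguished one in each region are closed. -/
def zetaSL2 (R : Type*) [CommRing R] (v : Rˣ) : Subalgebra R (T.FencingTorus R v) :=
  T.gateInvariants R v {w | w ≠ N.base (T.region w)}

/-- The algebra `ζ_{PGL₂}`. -/
def zetaPGL2 (R : Type*) [CommRing R] (v : Rˣ) : Subalgebra R (T.FencingTorus R v) :=
  T.fencingPGL2 R v ⊓ N.zetaSL2 R v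

/-- The algebra `χ_{PGL₂}`: the distinguished gates at the punctures are closed as well. -/
def chiPGL2 (R : Type*) [CommRing R] (v : Rˣ) : Subalgebra R (T.FencingTorus R v) :=
  N.zetaPGL2 R v ⊓
    T.gateInvariants R v {w | ¬ T.IsMarked (T.region w) ∧ w = N.base (T.region w)}

/-- The exponent of `Z_s`, the Weyl-ordered product of the long edge `s` and of the short edges on
the clockwise paths from the distinguished vertices to the two ends of `s`. -/
def zVec (s : Side F) : T.Lattice :=
  T.longVec s + T.pathVec (N.base (T.region (src s))) (src s) +
    T.pathVec (N.base (T.region (tgt s))) (tgt s)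

open Classical in
/-- The exponent of `X̃_s`.  The edge-end at the start of an interior side `s` is preceded clockwise
by an end of `prev s` and followed by an end of `next (glue s)`; the edge-end at the end point of
`s` is preceded by an end of `prev (glue s)` and followed by an end of `next s`.  A boundary side
`s` runs counterclockwise along the boundary. -/
def xTildeVec (s : Side F) : T.Lattice :=
  if T.glue (T.outer s) = T.outer s then
    N.zVec (T.outer s) + N.zVec (prev (T.outer s)) - N.zVec (next (T.outer s))
  else
    N.zVec (prev (T.outer s)) - N.zVec (next (T.glue (T.outer s))) +
      N.zVec (prev (T.glue (T.outer s))) - N.zVec (next (T.outer s))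

open Classical in
/-- The number `ε_p(s)`: it is `1` if an end of `s` is the first or the last edge-end at the
puncture `p`, and `-1` if `s` is the side opposite to the distinguished angle at `p`. -/
def notchExp (p : T.Puncture) (s : Side F) : ℤ :=
  if T.edge s = T.edge (N.base p.1).1 ∨ T.edge s = T.edge (prev (N.base p.1).1) then 1
  else if T.edge s = T.edge (next (N.base p.1).1) then -1
  else 0

open Classical in
/-- The exponent of `α_s`. -/
def alphaEdgeVec [Fintype F] (s : Side F) : T.Lattice :=
  (∑ p : T.Puncture, N.notchExp p (T.outer s) • T.alphaVec p.1) +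
    if T.IsInner s then (2 : ℤ) • T.alphaVec (T.innerRegion s) else 0

end Notching

end IdealTriangulation

end

/-!
Everything happens on exponents: `ι` is induced by a linear map `clusterMap` from `ℤ^edges` to the
lattice of exponents of the fencing graph torus, and the theorem says that this map preserves the
forms (`form_clusterMap`), is injective (`clusterMap_injective`), and has as its image the set
of exponents of the monomials in `χ_{PGL₂}` (`exists_clusterMap_eq`).

The key is a simple description of that image.  Call an exponent *balanced* if its weights vanish
at all fencing vertices other than the distinguished ones of the marked points; these are the end
points of the boundary sides.  A balanced exponent is determined by its *corner coordinates* `c_s`,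
the exponents of the short edges of the hexagons (`Balanced.eq_zero`), and `c_s + c_{next s}` takes
the same value on the two sides of an edge (`Balanced.cornerCoord_add_next`).  For exponents in the
lattice of `PGL₂` these sums are even (`even_cornerCoord_add_next`), so that there is a function `n`
on the edges with `c_s + c_{next s} = 2 n_s`, hence `c_s = n_s + n_{prev s} - n_{next s}`.  The
*edge coordinates* `n` thus embed the lattice of `χ_{PGL₂}` into `ℤ^edges`.

It remains to compute the edge coordinates of the images of the cluster variables.  The path
exponents in `Z_s` telescope along the corners between neighbouring edge-ends, except that crossing
the distinguished angle of a puncture `p` produces `α_p`; the factor `α_s` doubles these terms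
(`xTildeVec_add_alphaEdgeVec`).  Unless `s` is the internal edge of a self-folded triangle,
the result has the edge coordinates
`-δ_s + ∑_p ε_p(s) N_p`, and for a boundary side there is one more summand `N_m`, where `m` is the
marked point at which the side starts and `N_r` counts the ends of the edges in the region `r`
(`cornerCoord_edgeVec`).  The internal edge `s` of a self-folded triangle contributes the exponent of
the outer edge plus `2 α_p`, which has the edge coordinates `δ_s`; adding the exponent of the outer
edge is a unimodular change (`edgeVec_of_isInner`, `span_addOuter`).  Summing these vectors with the
coefficients `N_r` shows that their span contains all the `N_r` that occur, and hence is everything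
(`span_edgeImage`); a surjective endomorphism of `ℤ^edges` is injective, so that they form a basis.

For the forms, pairing a short edge with an exponent gives the sum of the weights at its two ends
(`form_shortVec`), and pairing a long edge gives corner coordinates and weights (`form_longVec`).
Hence the `α_p` of the punctures pair to zero with balanced exponents, the contributions of the
boundary cancel, and the exchange matrix remains (`form_edgeVec`, `exchange_eq`).
-/

noncomputable section

/-! ### Homomorphisms and subalgebras of quantum tori -/

namespace QuantumTorus

variable {R : Type*} [CommRing R] {v : Rˣ} {L L' : Type*} [AddCommGroup L] [AddCommGroup L']
  {B : L →ₗ[ℤ] L →ₗ[ℤ] ℤ} {B' : L' →ₗ[ℤ] L' →ₗ[ℤ] ℤ}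

theorem weyl_add (l m : L) :
    weyl R v B (l + m) = ((v ^ (-B l m) : Rˣ) : R) • (weyl R v B l * weyl R v B m) := by
  rw [weyl_mul_weyl, smul_smul, ← Units.val_mul, ← zpow_add]
  simp

/-- An additive map of lattices that preserves the forms induces a homomorphism of quantum tori,
which sends Weyl-ordered monomials to Weyl-ordered monomials. -/
def map (R : Type*) [CommRing R] (v : Rˣ) (φ : L →ₗ[ℤ] L')
    (h : ∀ l m, B' (φ l) (φ m) = B l m) :
    QuantumTorus R v B →ₐ[R] QuantumTorus R v B' :=
  let f : QuantumTorus R v B →ₗ[R] QuantumTorus R v B' := Finsupp.lmapDomain R R φ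
  have hf : ∀ l, f (weyl R v B l) = weyl R v B' (φ l) := fun _ => Finsupp.mapDomain_single
  AlgHom.ofLinearMap f (by rw [one_def, hf, map_zero, one_def]) (by
    intro x y
    refine induction (P := fun x => f (x * y) = f x * f y) x (by simp) ?_ ?_
    · intro x x' hx hx'
      rw [add_mul, map_add, map_add, add_mul, hx, hx']
    · intro c l
      refine induction (P := fun y => f (c • weyl R v B l * y) = f (c • weyl R v B l) * f y) y
        (by simp) ?_ ?_
      · intro y y' hy hy'
        rw [mul_add, map_add, map_add, mul_add, hy, hy']
      · intro d m
        rw [smul_mul_smul_comm, map_smul, map_smul, map_smul, smul_mul_smul_comm, weyl_mul_weyl,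
          map_smul, hf, hf, hf, weyl_mul_weyl, h, map_add])

theorem map_weyl (φ : L →ₗ[ℤ] L') (h : ∀ l m, B' (φ l) (φ m) = B l m) (l : L) :
    map R v φ h (weyl R v B l) = weyl R v B' (φ l) :=
  Finsupp.mapDomain_single

theorem map_injective (φ : L →ₗ[ℤ] L') (h : ∀ l m, B' (φ l) (φ m) = B l m)
    (hφ : Function.Injective φ) : Function.Injective (map R v φ h) :=
  Finsupp.mapDomain_injective hφ

/-- A homomorphism out of a quantum torus is determined by its values on the monomials whose
exponents generate the lattice, because monomials are invertible. -/
theorem algHom_ext {A : Type*} [Ring A] [Algebra R A] {f g : QuantumTorus R v B →ₐ[R] A}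
    {S : Set L} (hS : AddSubgroup.closure S = ⊤)
    (h : ∀ l ∈ S, f (weyl R v B l) = g (weyl R v B l)) : f = g := by
  have key : ∀ l : L, f (weyl R v B l) = g (weyl R v B l) := by
    intro l
    have hl : l ∈ AddSubgroup.closure S := hS ▸ AddSubgroup.mem_top l
    induction hl using AddSubgroup.closure_induction with
    | mem l hl => exact h l hl
    | zero => rw [← one_def, map_one, map_one]
    | add l m _ _ hl hm => rw [weyl_add, map_smul, map_smul, map_mul, map_mul, hl, hm]
    | neg l _ hl =>
      -- `weyl l` and `weyl (-l)` are inverse to each other up to the scalar `c`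
      set c : R := ((v ^ (-B l l) : Rˣ) : R)
      have hc : IsUnit c := Units.isUnit _
      have h1 : weyl R v B l * weyl R v B (-l) = c • 1 := by
        rw [weyl_mul_weyl, add_neg_cancel, map_neg]; rfl
      have h2 : weyl R v B (-l) * weyl R v B l = c • 1 := by
        rw [weyl_mul_weyl, neg_add_cancel, map_neg, LinearMap.neg_apply]; rfl
      have h3 : f (weyl R v B l) * f (weyl R v B (-l)) = c • 1 := by
        rw [← map_mul, h1, map_smul, map_one]
      have h4 : g (weyl R v B (-l)) * g (weyl R v B l) = c • 1 := by
        rw [← map_mul, h2, map_smul, map_one]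
      have h5 : c • f (weyl R v B (-l)) = c • g (weyl R v B (-l)) := by
        calc c • f (weyl R v B (-l))
            = g (weyl R v B (-l)) * g (weyl R v B l) * f (weyl R v B (-l)) := by
              rw [h4, smul_mul_assoc, one_mul]
          _ = c • g (weyl R v B (-l)) := by
              rw [mul_assoc, ← hl, h3, mul_smul_comm, mul_one]
      exact hc.smul_left_cancel.1 h5
  refine AlgHom.ext fun x => ?_
  refine induction (P := fun x => f x = g x) x (by simp) ?_ ?_
  · intro x y hx hy
    rw [map_add, map_add, hx, hy]
  · intro c l
    rw [map_smul, map_smul, key]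

theorem mem_of_support {x : QuantumTorus R v B} {A : Subalgebra R (QuantumTorus R v B)}
    (h : ∀ l ∈ x.support, weyl R v B l ∈ A) : x ∈ A := by
  rw [eq_sum x]
  exact Subalgebra.sum_mem _ fun l hl => Subalgebra.smul_mem _ (h l hl) _

theorem eq_of_mem_support_weyl {l m : L} (h : m ∈ (weyl R v B l).support) : m = l :=
  Finset.mem_singleton.1 (Finsupp.support_single_subset h)

theorem weyl_mem_invariants {I : Type*} {wt : I → L →ₗ[ℤ] ℤ} {S : Set I} {l : L}
    (h : ∀ i ∈ S, wt i l = 0) : weyl R v B l ∈ invariants R v B wt S := by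
  intro m hm i hi
  rw [eq_of_mem_support_weyl hm, h i hi]

/-- The subalgebra generated by a set of monomials contains all monomials whose exponents lie in
the subgroup generated by the exponents, provided that set of exponents is symmetric. -/
theorem weyl_mem_of_mem_closure {S : Set L} (hneg : ∀ l ∈ S, -l ∈ S)
    {A : Subalgebra R (QuantumTorus R v B)} (hA : ∀ l ∈ S, weyl R v B l ∈ A) {l : L}
    (hl : l ∈ AddSubgroup.closure S) : weyl R v B l ∈ A := by
  have hl' : l ∈ AddSubmonoid.closure S := by
    rw [← AddSubgroup.mem_toAddSubmonoid, AddSubgroup.closure_toAddSubmonoid,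
      Set.union_eq_self_of_subset_right fun m hm => neg_neg m ▸ hneg _ hm] at hl
    exact hl
  clear hl
  induction hl' using AddSubmonoid.closure_induction with
  | mem l hl => exact hA l hl
  | zero => exact one_mem A
  | add l m _ _ ihl ihm =>
    rw [weyl_add]
    exact A.smul_mem (A.mul_mem ihl ihm) _

theorem support_subset_of_mem_adjoin {X : Set (QuantumTorus R v B)} {K : AddSubgroup L}
    (hX : ∀ x ∈ X, ∃ l ∈ K, x = weyl R v B l) {x : QuantumTorus R v B}
    (hx : x ∈ Algebra.adjoin R X) : ∀ l ∈ x.support, l ∈ K := by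
  let M : Submodule R (QuantumTorus R v B) := Finsupp.supported R R (K : Set L)
  have hM : ∀ z : QuantumTorus R v B, z ∈ M ↔ ∀ l ∈ z.support, l ∈ K :=
    fun z => Finsupp.mem_supported R (show L →₀ R from z)
  have hw : ∀ l ∈ K, weyl R v B l ∈ M := fun l hl => Finsupp.single_mem_supported R 1 hl
  refine (hM x).1 ?_
  induction hx using Algebra.adjoin_induction with
  | mem x hx =>
    obtain ⟨l, hl, rfl⟩ := hX x hx
    exact hw l hl
  | algebraMap r =>
    rw [Algebra.algebraMap_eq_smul_one]
    exact M.smul_mem _ (hw 0 K.zero_mem)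
  | add x y _ _ hx hy => exact M.add_mem hx hy
  | mul x y _ _ hx hy =>
    rw [eq_sum x, eq_sum y, Finset.sum_mul]
    refine Submodule.sum_mem _ fun l hl => ?_
    rw [Finset.mul_sum]
    refine Submodule.sum_mem _ fun m hm => ?_
    rw [smul_mul_smul_comm, weyl_mul_weyl]
    exact M.smul_mem _ (M.smul_mem _ (hw _ (K.add_mem ((hM x).1 hx l hl) ((hM y).1 hy m hm))))

theorem formOf_single {G : Type*} (f : G → G → ℤ) (g h : G) :
    formOf f (Finsupp.single g 1) (Finsupp.single h 1) = f g h := by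
  simp [formOf]

end QuantumTorus

namespace IdealTriangulation

variable {F : Type*} {T : IdealTriangulation F}

/-! ### Edges and regions -/

theorem edge_eq_iff {s t : Side F} : T.edge s = T.edge t ↔ s = t ∨ s = T.glue t := by
  constructor
  · intro h
    have h' := Quot.eqvGen_exact h
    clear h
    induction h' with
    | rel s t h => right; rw [h, T.glue_glue]
    | refl s => left; rfl
    | symm s t _ ih =>
      rcases ih with rfl | rfl
      · left; rfl
      · right; rw [T.glue_glue]
    | trans r s t _ _ ih1 ih2 =>
      rcases ih1 with rfl | rfl <;> rcases ih2 with rfl | rfl <;> simp [T.glue_glue]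
  · rintro (rfl | rfl)
    · rfl
    · exact (Quot.sound (r := fun s t : Side F => t = T.glue s) (a := t) rfl).symm

theorem edge_glue (s : Side F) : T.edge (T.glue s) = T.edge s :=
  edge_eq_iff.2 (Or.inr rfl)

theorem exists_edge_eq (e : T.Edge) : ∃ s, T.edge s = e := Quot.exists_rep e

open Classical in
theorem sum_edge [Fintype F] {M : Type*} [AddCommMonoid M] (s : Side F) (f : Side F → M) :
    ∑ u, (if T.edge u = T.edge s then f u else 0) =
      f s + if T.glue s = s then 0 else f (T.glue s) := by
  rw [← Finset.sum_filter]
  split_ifs with h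
  · have : (Finset.univ.filter fun u => T.edge u = T.edge s) = {s} := by
      ext u; simp [edge_eq_iff, h]
    rw [this, Finset.sum_singleton, add_zero]
  · have : (Finset.univ.filter fun u => T.edge u = T.edge s) = {s, T.glue s} := by
      ext u; simp [edge_eq_iff]
    rw [this, Finset.sum_pair (Ne.symm h)]

theorem region_tail_eq_head (e : T.ShortEdge) : T.region e.tail = T.region e.head :=
  Quot.sound ⟨e, rfl, rfl⟩

theorem region_src (s : Side F) : T.region (src s) = T.region (tgt (prev s)) :=
  (region_tail_eq_head (.hex s)).symm

theorem region_tgt (s : Side F) : T.region (tgt s) = T.region (src (next s)) := by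
  rw [region_src, prev_next]

theorem region_src_of_glue_ne {s : Side F} (h : T.glue s ≠ s) :
    T.region (src s) = T.region (tgt (T.glue s)) :=
  region_tail_eq_head (.dig s h)

theorem region_tgt_of_glue_ne {s : Side F} (h : T.glue s ≠ s) :
    T.region (tgt s) = T.region (src (T.glue s)) := by
  rw [region_src_of_glue_ne (s := T.glue s), T.glue_glue]
  rw [T.glue_glue]; exact h.symm

/-- A property of fencing vertices that is invariant along short edges only depends on the
region. -/
theorem iff_of_region_eq {P : Vertex F → Prop}
    (h : ∀ e : T.ShortEdge, P e.tail ↔ P e.head) {u w : Vertex F}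
    (huw : T.region u = T.region w) : P u ↔ P w := by
  have h' := Quot.eqvGen_exact huw
  clear huw
  induction h' with
  | rel u w h' => obtain ⟨e, rfl, rfl⟩ := h'; exact h e
  | refl s => rfl
  | symm s t _ ih => exact ih.symm
  | trans r s t _ _ ih1 ih2 => exact ih1.trans ih2

theorem isMarked_src {s : Side F} (h : T.glue s = s) : T.IsMarked (T.region (src s)) :=
  ⟨_, h, rfl⟩

theorem isMarked_tgt {s : Side F} (h : T.glue s = s) : T.IsMarked (T.region (tgt s)) :=
  ⟨_, h, rfl⟩

/-! ### Walking clockwise around a vertex -/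

theorem step_tgt (s : Side F) : T.step (tgt s) = src (next s) := rfl

theorem step_src {s : Side F} (h : T.glue s ≠ s) : T.step (src s) = tgt (T.glue s) := by
  simp [step, h]

theorem step_src_of_glue_eq {s : Side F} (h : T.glue s = s) : T.step (src s) = src s := by
  simp [step, h]

theorem step_tail (e : T.ShortEdge) : T.step e.tail = e.head := by
  cases e with
  | hex s => simp [ShortEdge.tail, ShortEdge.head, step_tgt, next_prev]
  | dig s h => simp [ShortEdge.tail, ShortEdge.head, step_src h]

theorem region_step (w : Vertex F) : T.region (T.step w) = T.region w := by
  obtain ⟨s, _ | _⟩ := w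
  · by_cases h : T.glue s = s
    · rw [step_src_of_glue_eq h]
    · rw [step_src h, ← region_src_of_glue_ne h]
  · rw [step_tgt, ← region_tgt]

theorem region_step_iterate (n : ℕ) (w : Vertex F) : T.region (T.step^[n] w) = T.region w := by
  induction n with
  | zero => rfl
  | succ n ih => rw [Function.iterate_succ_apply', region_step, ih]

variable (T) in
/-- The permutation that sends a fencing vertex to the clockwise next one; at a boundary side it
passes from the last fencing vertex of a marked point to the first one of a neighbouring marked
point. -/
def stepPerm : Equiv.Perm (Vertex F) where
  toFun := fun w => match w with
    | (s, true) => src (next s)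
    | (s, false) => tgt (T.glue s)
  invFun := fun w => match w with
    | (s, true) => src (T.glue s)
    | (s, false) => tgt (prev s)
  left_inv := by rintro ⟨s, _ | _⟩ <;> simp [T.glue_glue, prev_next]
  right_inv := by rintro ⟨s, _ | _⟩ <;> simp [T.glue_glue, next_prev]

theorem stepPerm_apply {w : Vertex F} (h : T.step w ≠ w) : T.stepPerm w = T.step w := by
  obtain ⟨s, _ | _⟩ := w
  · by_cases h' : T.glue s = s
    · exact absurd (step_src_of_glue_eq h') h
    · rw [step_src h']; rfl
  · rfl

theorem step_ne_of_not_isMarked {w : Vertex F} (h : ¬ T.IsMarked (T.region w)) :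
    T.step w ≠ w := by
  obtain ⟨s, _ | _⟩ := w
  · have h' : T.glue s ≠ s := fun h' => h (isMarked_src h')
    rw [step_src h']
    simp
  · rw [step_tgt]; simp

theorem eq_of_step_eq {u w : Vertex F} (hu : T.step u ≠ u) (hw : T.step w ≠ w)
    (h : T.step u = T.step w) : u = w := by
  rw [← stepPerm_apply hu, ← stepPerm_apply hw] at h
  exact T.stepPerm.injective h

theorem iterate_of_step_eq {w : Vertex F} (h : T.step w = w) (n : ℕ) : T.step^[n] w = w :=
  Function.iterate_fixed h n

theorem step_tail_ne (e : T.ShortEdge) : T.step e.tail ≠ e.tail := by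
  cases e with
  | hex s => simp [ShortEdge.tail, step_tgt]
  | dig s h => simp [ShortEdge.tail, step_src h]

namespace Notching

variable (N : T.Notching)

theorem base_ne_of_head (e : T.ShortEdge) (h : T.IsMarked (T.region e.head)) :
    e.head ≠ N.base (T.region e.head) := by
  obtain ⟨s, hs, hb⟩ := N.base_marked _ h
  rw [hb]
  intro h'
  cases e with
  | hex r => simp [ShortEdge.head] at h'
  | dig r hr =>
    simp only [ShortEdge.head, Prod.mk.injEq, and_true] at h'
    subst h'
    rw [T.glue_glue] at hs
    exact hr hs.symm

/-- The fencing vertices around a puncture form a cycle. -/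
theorem exists_iterate_eq_self [Finite F] {w : Vertex F} (h : ¬ T.IsMarked (T.region w)) :
    ∃ n, T.step^[n + 1] w = w := by
  have key : ∀ n, T.step^[n] w = (T.stepPerm ^ n) w := by
    intro n
    induction n with
    | zero => rfl
    | succ n ih =>
      rw [Function.iterate_succ_apply', ← stepPerm_apply, ih, pow_succ']
      · rfl
      · apply step_ne_of_not_isMarked
        rwa [region_step_iterate]
  have hpos := orderOf_pos T.stepPerm
  refine ⟨orderOf T.stepPerm - 1, ?_⟩
  rw [key, Nat.sub_add_cancel hpos, pow_orderOf_eq_one]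
  rfl

/-- Every fencing vertex is reached by walking clockwise from the distinguished one. -/
theorem exists_iterate_base [Finite F] (w : Vertex F) :
    ∃ n, T.step^[n] (N.base (T.region w)) = w := by
  set b := N.base (T.region w) with hb
  refine (iff_of_region_eq (P := fun u => T.region u = T.region w → ∃ n, T.step^[n] b = u)
    (fun e => ?_) (N.region_base (T.region w))).1 (fun _ => ⟨0, rfl⟩) rfl
  rw [region_tail_eq_head]
  refine imp_congr_right fun he => ?_
  constructor
  · rintro ⟨n, hn⟩
    exact ⟨n + 1, by rw [Function.iterate_succ_apply', hn, step_tail]⟩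
  · rintro ⟨n, hn⟩
    induction n with
    | zero =>
      -- the distinguished vertex has a predecessor only at a puncture
      have hn' : b = e.head := hn
      have hm : ¬ T.IsMarked (T.region w) := by
        intro hm
        rw [← he] at hm
        exact N.base_ne_of_head e hm (by rw [he, ← hb, hn'])
      have hm' : ¬ T.IsMarked (T.region b) := by rwa [hb, N.region_base]
      obtain ⟨k, hk⟩ := exists_iterate_eq_self hm'
      refine ⟨k, ?_⟩
      rw [Function.iterate_succ_apply'] at hk
      refine eq_of_step_eq ?_ (step_tail_ne e) (by rw [hk, step_tail, hn'])
      apply step_ne_of_not_isMarked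
      rwa [region_step_iterate]
    | succ n ih =>
      rw [Function.iterate_succ_apply'] at hn
      by_cases h : T.step (T.step^[n] b) = T.step^[n] b
      · exact ih (h ▸ hn)
      · exact ⟨n, eq_of_step_eq h (step_tail_ne e) (by rw [hn, step_tail])⟩

/-- At a marked point, the distinguished fencing vertex is the only end point of a boundary
side. -/
theorem base_eq_tgt [Finite F] {s : Side F} (h : T.glue s = s) :
    N.base (T.region (tgt s)) = tgt s := by
  obtain ⟨n, hn⟩ := N.exists_iterate_base (T := T) (tgt s)
  cases n with
  | zero => exact hn
  | succ n =>
    rw [Function.iterate_succ_apply'] at hn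
    exfalso
    generalize T.step^[n] (N.base (T.region (tgt s))) = u at hn
    obtain ⟨r, _ | _⟩ := u
    · by_cases hr : T.glue r = r
      · rw [step_src_of_glue_eq hr] at hn
        simp at hn
      · rw [step_src hr] at hn
        simp only [Prod.mk.injEq, and_true] at hn
        subst hn
        rw [T.glue_glue] at h
        exact hr h.symm
    · rw [step_tgt] at hn
      simp at hn

theorem eq_of_region_tgt_eq [Finite F] (N : T.Notching) {s t : Side F} (hs : T.glue s = s)
    (ht : T.glue t = t) (h : T.region (tgt s) = T.region (tgt t)) : s = t := by
  have h1 := N.base_eq_tgt hs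
  rw [h, N.base_eq_tgt ht] at h1
  simpa using h1.symm

/-- At a marked point there is only one starting point of a boundary side, namely the clockwise
last fencing vertex. -/
theorem eq_of_region_src_eq [Finite F] (N : T.Notching) {s t : Side F} (hs : T.glue s = s)
    (ht : T.glue t = t) (h : T.region (src s) = T.region (src t)) : s = t := by
  obtain ⟨m, hm⟩ := N.exists_iterate_base (T := T) (src s)
  obtain ⟨n, hn⟩ := N.exists_iterate_base (T := T) (src t)
  rw [h] at hm
  have h1 := iterate_of_step_eq (step_src_of_glue_eq hs) n
  have h2 := iterate_of_step_eq (step_src_of_glue_eq ht) m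
  rw [← hm, ← Function.iterate_add_apply] at h1
  rw [← hn, ← Function.iterate_add_apply, add_comm, h1, hm, hn] at h2
  simpa using h2

theorem exists_tgt_of_isMarked (N : T.Notching) {r : T.Region} (h : T.IsMarked r) :
    ∃ s, T.glue s = s ∧ T.region (tgt s) = r := by
  obtain ⟨s, hs, hb⟩ := N.base_marked r h
  exact ⟨s, hs, by rw [← hb, N.region_base]⟩

/-- Every marked point is the starting point of a boundary side, since the boundary sides are as
many as the marked points. -/
theorem exists_src_of_isMarked [Finite F] (N : T.Notching) {r : T.Region} (h : T.IsMarked r) :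
    ∃ s, T.glue s = s ∧ T.region (src s) = r := by
  choose p hp hp' using fun s : {s : Side F // T.glue s = s} =>
    N.exists_tgt_of_isMarked (isMarked_src s.2)
  let g : {s : Side F // T.glue s = s} → {s : Side F // T.glue s = s} := fun s => ⟨p s, hp s⟩
  have hg : Function.Injective g := by
    intro s t hst
    have h1 : p s = p t := congrArg Subtype.val hst
    refine Subtype.ext (N.eq_of_region_src_eq s.2 t.2 ?_)
    rw [← hp' s, ← hp' t, h1]
  obtain ⟨t, ht, rfl⟩ := N.exists_tgt_of_isMarked h
  obtain ⟨s, hs⟩ := Finite.surjective_of_injective hg ⟨t, ht⟩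
  have hps : p s = t := congrArg Subtype.val hs
  exact ⟨s, s.2, by rw [← hp' s, hps]⟩

/-! ### Path exponents -/

/-- The last fencing vertex of its region on the clockwise walk from the distinguished one. -/
def IsLast (w : Vertex F) : Prop := T.step w = w ∨ T.step w = N.base (T.region w)

/-- The exponent of the product of the short edges on the clockwise path from the distinguished
fencing vertex of the region to the given one. -/
def basePath (w : Vertex F) : T.Lattice := T.pathVec (N.base (T.region w)) w

theorem basePath_step [Finite F] {w : Vertex F} (h1 : T.step w ≠ w)
    (h2 : T.step w ≠ N.base (T.region w)) :
    N.basePath (T.step w) = N.basePath w + T.outVec w := by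
  obtain ⟨d, hd⟩ : ∃ d, d = sInf {n : ℕ | T.step^[n] (N.base (T.region w)) = w} := ⟨_, rfl⟩
  have hne : {n : ℕ | T.step^[n] (N.base (T.region w)) = w}.Nonempty :=
    N.exists_iterate_base (T := T) w
  have hdw : T.step^[d] (N.base (T.region w)) = w := hd ▸ Nat.sInf_mem hne
  have hmin : ∀ k < d, T.step^[k] (N.base (T.region w)) ≠ w := fun k hk h =>
    absurd (Nat.sInf_le (s := {n : ℕ | T.step^[n] (N.base (T.region w)) = w}) h) (by omega)
  have hd' : sInf {n : ℕ | T.step^[n] (N.base (T.region w)) = T.step w} = d + 1 := by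
    have hmem : d + 1 ∈ {n : ℕ | T.step^[n] (N.base (T.region w)) = T.step w} := by
      rw [Set.mem_ofPred_eq, Function.iterate_succ_apply', hdw]
    refine le_antisymm (Nat.sInf_le hmem) (le_csInf ⟨_, hmem⟩ fun n hn => ?_)
    rw [Set.mem_ofPred_eq] at hn
    cases n with
    | zero => exact absurd hn.symm h2
    | succ k =>
      by_contra hk
      have hk : k < d := by omega
      rw [Function.iterate_succ_apply'] at hn
      by_cases hf : T.step (T.step^[k] (N.base (T.region w))) = T.step^[k] (N.base (T.region w))
      · have := iterate_of_step_eq hf (d - k)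
        rw [← Function.iterate_add_apply, Nat.sub_add_cancel hk.le, hdw] at this
        exact hmin k hk this.symm
      · exact hmin k hk (eq_of_step_eq hf h1 hn)
  rw [basePath, basePath, region_step, pathVec, pathVec, hd', ← hd, Finset.sum_range_succ, hdw]

/-- The clockwise walk from the distinguished fencing vertex to the last one meets every fencing
vertex of the region exactly once. -/
theorem basePath_add_outVec [Fintype F] {w : Vertex F} (h : N.IsLast w) :
    N.basePath w + T.outVec w = T.alphaVec (T.region w) := by
  classical
  set b := N.base (T.region w) with hb
  obtain ⟨d, hd⟩ : ∃ d, d = sInf {n : ℕ | T.step^[n] b = w} := ⟨_, rfl⟩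
  have hne : {n : ℕ | T.step^[n] b = w}.Nonempty := N.exists_iterate_base (T := T) w
  have hdw : T.step^[d] b = w := hd ▸ Nat.sInf_mem hne
  have hmin : ∀ k < d, T.step^[k] b ≠ w := fun k hk h =>
    absurd (Nat.sInf_le (s := {n : ℕ | T.step^[n] b = w}) h) (by omega)
  have hcover : ∀ n, ∃ i < d + 1, T.step^[i] b = T.step^[n] b := by
    intro n
    induction n with
    | zero => exact ⟨0, by omega, rfl⟩
    | succ n ih =>
      obtain ⟨i, hi, hi'⟩ := ih
      rw [Function.iterate_succ_apply', ← hi']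
      rcases Nat.lt_or_ge i d with hid | hid
      · exact ⟨i + 1, by omega, Function.iterate_succ_apply' ..⟩
      · have : i = d := by omega
        subst this
        rw [hdw]
        rcases h with h | h
        · exact ⟨i, hi, by rw [hdw, h]⟩
        · exact ⟨0, by omega, h.symm⟩
  have hinj : ∀ i j, i < j → j < d + 1 → T.step^[i] b ≠ T.step^[j] b := by
    intro i j hij hj h'
    have h1 : T.step^[d - j] (T.step^[i] b) = w := by
      rw [h', ← Function.iterate_add_apply, Nat.sub_add_cancel (by omega), hdw]
    rw [← Function.iterate_add_apply] at h1
    exact hmin _ (by omega) h1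
  rw [basePath, pathVec, ← hb, ← hd]
  conv_lhs => enter [2]; rw [← hdw]
  rw [← Finset.sum_range_succ (fun i => T.outVec (T.step^[i] b)), alphaVec, ← Finset.sum_filter]
  refine Finset.sum_bij (fun i _ => T.step^[i] b) ?_ ?_ ?_ (fun _ _ => rfl)
  · intro i _
    rw [Finset.mem_filter, region_step_iterate, hb, N.region_base]
    exact ⟨Finset.mem_univ _, rfl⟩
  · intro i hi j hj hij
    rw [Finset.mem_range] at hi hj
    rcases lt_trichotomy i j with hlt | heq | hlt
    · exact absurd hij (hinj i j hlt hj)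
    · exact heq
    · exact absurd hij.symm (hinj j i hlt hi)
  · intro u hu
    rw [Finset.mem_filter] at hu
    obtain ⟨n, hn⟩ := N.exists_iterate_base (T := T) u
    rw [hu.2, ← hb] at hn
    obtain ⟨i, hi, hi'⟩ := hcover n
    exact ⟨i, Finset.mem_range.2 hi, hi'.trans hn⟩

theorem basePath_base (r : T.Region) : N.basePath (N.base r) = 0 := by
  rw [basePath, N.region_base, pathVec]
  have : sInf {n : ℕ | T.step^[n] (N.base r) = N.base r} = 0 :=
    Nat.sInf_eq_zero.2 (Or.inl rfl)
  rw [this, Finset.range_zero, Finset.sum_empty]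

theorem basePath_tgt_glue [Finite F] {s : Side F} (h : T.glue s ≠ s) :
    N.basePath (tgt (T.glue s)) = N.basePath (src s) + T.outVec (src s) := by
  have hs := step_src h
  rw [← hs]
  refine N.basePath_step (by rw [hs]; simp) ?_
  by_cases hm : T.IsMarked (T.region (src s))
  · have := N.base_ne_of_head (.dig s h) (by
      rw [← region_tail_eq_head]; exact hm)
    rwa [← region_tail_eq_head, ← step_tail] at this
  · obtain ⟨t, ht⟩ := N.base_puncture _ hm
    rw [hs, ht]
    simp

open Classical in
theorem basePath_src [Fintype F] (s : Side F) :
    N.basePath (src s) = N.basePath (tgt (prev s)) + T.outVec (tgt (prev s)) -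
      if src s = N.base (T.region (src s)) then T.alphaVec (T.region (src s)) else 0 := by
  have hs : T.step (tgt (prev s)) = src s := by rw [step_tgt, next_prev]
  have hr := region_src (T := T) s
  split_ifs with h
  · rw [N.basePath_add_outVec (Or.inr (by rw [hs, ← hr]; exact h)), ← hr, sub_self]
    conv_lhs => rw [h]
    exact N.basePath_base _
  · rw [sub_zero, ← N.basePath_step (by rw [hs]; simp) (by rw [hs, ← hr]; exact h), hs]

theorem basePath_src_of_glue_eq [Fintype F] {s : Side F} (h : T.glue s = s) :
    N.basePath (src s) = T.alphaVec (T.region (src s)) := by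
  rw [← N.basePath_add_outVec (w := src s) (Or.inl (step_src_of_glue_eq h))]
  simp [outVec, h]

end Notching

/-! ### Linear functionals on the lattice of exponents -/

theorem lattice_hom_ext {M : Type*} [AddCommGroup M] {f g : T.Lattice →ₗ[ℤ] M}
    (hlong : ∀ s, f (T.longVec s) = g (T.longVec s))
    (hshort : ∀ e, f (T.shortVec e) = g (T.shortVec e)) : f = g := by
  refine Submodule.linearMap_qext _ (Finsupp.lhom_ext' fun x => LinearMap.ext_ring ?_)
  cases x with
  | long s => exact hlong s
  | short e => exact hshort e

variable (T) in
open Classical in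
/-- The corner coordinate: the exponent with which the short edge of the hexagon at the corner where
the side `s` starts occurs in a monomial. -/
def cornerCoord (s : Side F) : T.Lattice →ₗ[ℤ] ℤ :=
  (Submodule.span ℤ T.digonRelations).liftQ
    (Finsupp.linearCombination ℤ fun g : T.Gen => match g with
      | .short (.hex r) => if r = s then (1 : ℤ) else 0
      | _ => 0)
    (by
      rw [Submodule.span_le]
      rintro r ⟨s, h, h', rfl⟩
      rw [SetLike.mem_coe, LinearMap.mem_ker]
      simp)

theorem form_mk_single (x y : T.Gen) :
    T.form (Submodule.Quotient.mk (Finsupp.single x 1))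
      (Submodule.Quotient.mk (Finsupp.single y 1)) = fencingExp x y :=
  QuantumTorus.formOf_single _ x y

theorem weight_mk_single (w : Vertex F) (x : T.Gen) :
    T.weight w (Submodule.Quotient.mk (Finsupp.single x 1)) = genWeight w x := by
  simp [weight]

theorem form_longVec_longVec (s t : Side F) : T.form (T.longVec s) (T.longVec t) = 0 :=
  form_mk_single ..

theorem cornerCoord_longVec (s t : Side F) : T.cornerCoord s (T.longVec t) = 0 := by
  simp [cornerCoord, longVec]

open Classical in
theorem cornerCoord_hex (s t : Side F) :
    T.cornerCoord s (T.shortVec (.hex t)) = if t = s then 1 else 0 := by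
  simp [cornerCoord, shortVec]

theorem cornerCoord_dig (s t : Side F) (h : T.glue t ≠ t) :
    T.cornerCoord s (T.shortVec (.dig t h)) = 0 := by
  simp [cornerCoord, shortVec]

open Classical in
theorem weight_src_longVec (s t : Side F) :
    T.weight (src s) (T.longVec t) = if t = s then 1 else 0 := by
  rw [longVec, weight_mk_single]
  simp [genWeight, eq_comm]

open Classical in
theorem weight_tgt_longVec (s t : Side F) :
    T.weight (tgt s) (T.longVec t) = if t = s then 1 else 0 := by
  rw [longVec, weight_mk_single]
  simp [genWeight, eq_comm]

open Classical in
theorem weight_src_hex (s t : Side F) :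
    T.weight (src s) (T.shortVec (.hex t)) = if t = s then -1 else 0 := by
  rw [shortVec, weight_mk_single]
  simp [genWeight, ShortEdge.tail, ShortEdge.head, eq_comm]

open Classical in
theorem weight_tgt_hex (s t : Side F) :
    T.weight (tgt s) (T.shortVec (.hex t)) = if t = next s then 1 else 0 := by
  rw [shortVec, weight_mk_single]
  have h1 := next_prev t
  have h2 := prev_next s
  simp only [genWeight, ShortEdge.tail, ShortEdge.head, Prod.mk.injEq]
  split_ifs <;> grind

open Classical in
theorem weight_src_dig (s t : Side F) (h : T.glue t ≠ t) :
    T.weight (src s) (T.shortVec (.dig t h)) = if t = s then 1 else 0 := by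
  rw [shortVec, weight_mk_single]
  simp [genWeight, ShortEdge.tail, ShortEdge.head, eq_comm]

open Classical in
theorem weight_tgt_dig (s t : Side F) (h : T.glue t ≠ t) :
    T.weight (tgt s) (T.shortVec (.dig t h)) = if t = T.glue s then -1 else 0 := by
  rw [shortVec, weight_mk_single]
  have h1 := T.glue_glue t
  have h2 := T.glue_glue s
  simp only [genWeight, ShortEdge.tail, ShortEdge.head, Prod.mk.injEq]
  split_ifs <;> grind

/-- The exponent of the short edge of a rectangle at the start of an interior side, and zero for a
boundary side. -/
abbrev digVec (T : IdealTriangulation F) (s : Side F) : T.Lattice := T.outVec (src s)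

theorem digVec_of_eq {s : Side F} (h : T.glue s = s) : T.digVec s = 0 := by
  simp [digVec, outVec, h]

theorem digVec_of_ne {s : Side F} (h : T.glue s ≠ s) :
    T.digVec s = T.shortVec (.dig s h) := by
  simp [digVec, outVec, h]

theorem outVec_tgt (s : Side F) : T.outVec (tgt s) = T.shortVec (.hex (next s)) := rfl

theorem digVec_add_longVec (s : Side F) :
    T.digVec s + T.longVec (T.glue s) = T.digVec (T.glue s) + T.longVec s := by
  by_cases h : T.glue s = s
  · rw [h]
  · have h' : T.glue (T.glue s) ≠ T.glue s := by rw [T.glue_glue]; exact Ne.symm h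
    rw [digVec_of_ne h, digVec_of_ne h']
    refine (Submodule.Quotient.eq _).2 (Submodule.subset_span ⟨s, h, h', rfl⟩)

theorem cornerCoord_digVec (s t : Side F) : T.cornerCoord s (T.digVec t) = 0 := by
  by_cases h : T.glue t = t
  · rw [digVec_of_eq h, map_zero]
  · rw [digVec_of_ne h, cornerCoord_dig]

open Classical in
theorem weight_src_digVec (s t : Side F) :
    T.weight (src s) (T.digVec t) = if t = s ∧ T.glue s ≠ s then 1 else 0 := by
  by_cases h : T.glue t = t
  · rw [digVec_of_eq h, map_zero, if_neg]
    rintro ⟨rfl, h'⟩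
    exact h' h
  · rw [digVec_of_ne h, weight_src_dig]
    refine if_congr ⟨?_, And.left⟩ rfl rfl
    rintro rfl
    exact ⟨rfl, h⟩

open Classical in
theorem weight_tgt_digVec {s : Side F} (hs : T.glue s ≠ s) (t : Side F) :
    T.weight (tgt s) (T.digVec t) = if t = T.glue s then -1 else 0 := by
  by_cases h : T.glue t = t
  · rw [digVec_of_eq h, map_zero, if_neg]
    rintro rfl
    rw [T.glue_glue] at h
    exact hs h.symm
  · rw [digVec_of_ne h, weight_tgt_dig]

/-- Pairing with a short edge is the sum of the weights at its two ends. -/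
theorem form_shortVec (e : T.ShortEdge) :
    T.form (T.shortVec e) = T.weight e.head + T.weight e.tail := by
  refine lattice_hom_ext (fun s => ?_) fun e' => ?_
  · rw [LinearMap.add_apply, shortVec, longVec, form_mk_single, weight_mk_single,
      weight_mk_single]
    cases e with
    | hex r =>
      have h1 := prev_ne r
      simp only [fencingExp, genWeight, Meets, ShortEdge.tail, ShortEdge.head, Prod.mk.injEq]
      split_ifs <;> grind
    | dig r h =>
      simp only [fencingExp, genWeight, Meets, ShortEdge.tail, ShortEdge.head, Prod.mk.injEq]
      split_ifs <;> grind
  · rw [LinearMap.add_apply, shortVec, shortVec, form_mk_single, weight_mk_single,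
      weight_mk_single]
    have h1 : ∀ e e' : T.ShortEdge, e.head = e'.head → e.tail = e'.tail := by
      rintro (r | ⟨r, h⟩) (r' | ⟨r', h'⟩) <;> simp only [ShortEdge.tail, ShortEdge.head,
        Prod.mk.injEq] <;> grind [T.glue_glue r, T.glue_glue r']
    have h2 : ∀ e e' : T.ShortEdge, e.tail = e'.tail → e.head = e'.head := by
      intro e e' h
      rw [← step_tail, ← step_tail, h]
    have h3 : ∀ e : T.ShortEdge, e.tail ≠ e.head := by
      intro e h
      exact step_tail_ne e (by rw [step_tail, h])
    have := h1 e e'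
    have := h2 e e'
    have := h3 e
    have := h3 e'
    simp only [fencingExp, genWeight]
    split_ifs <;> grind

theorem form_longVec (s : Side F) :
    T.form (T.longVec s) =
      T.weight (tgt s) - T.weight (src s) -
        (2 : ℤ) • (T.cornerCoord s + T.cornerCoord (next s)) := by
  refine lattice_hom_ext (fun t => ?_) fun e => ?_
  · simp only [LinearMap.sub_apply, LinearMap.smul_apply, LinearMap.add_apply,
      form_longVec_longVec, weight_tgt_longVec, weight_src_longVec, cornerCoord_longVec]
    simp
  · have hf : T.form (T.longVec s) (T.shortVec e) = fencingExp (.long s) (.short e) :=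
      form_mk_single ..
    cases e with
    | hex r =>
      simp only [LinearMap.sub_apply, LinearMap.smul_apply, LinearMap.add_apply, hf,
        weight_src_hex, weight_tgt_hex, cornerCoord_hex, fencingExp, Meets, ShortEdge.tail,
        ShortEdge.head, Prod.mk.injEq]
      have h1 := next_prev r
      have h2 := prev_next s
      have h3 := next_ne s
      split_ifs <;> grind
    | dig r h =>
      simp only [LinearMap.sub_apply, LinearMap.smul_apply, LinearMap.add_apply, hf,
        weight_src_dig, weight_tgt_dig, cornerCoord_dig, fencingExp, Meets, ShortEdge.tail,
        ShortEdge.head, Prod.mk.injEq]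
      have h1 := T.glue_glue r
      have h2 := T.glue_glue s
      split_ifs <;> grind

theorem form_swap (x y : T.Lattice) : T.form x y = -T.form y x := by
  have h : T.form = -T.form.flip := by
    refine lattice_hom_ext (fun s => ?_) fun e => ?_ <;>
    refine lattice_hom_ext (fun t => ?_) fun e' => ?_ <;>
    simp only [LinearMap.neg_apply, LinearMap.flip_apply, longVec, shortVec, form_mk_single] <;>
    exact fencingExp_neg T _ _
  simpa using LinearMap.congr_fun (LinearMap.congr_fun h x) y

theorem weight_tgt_of_glue_eq {s : Side F} (h : T.glue s = s) :
    T.weight (tgt s) = T.weight (src s) + (T.cornerCoord s + T.cornerCoord (next s)) := by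
  refine lattice_hom_ext (fun t => ?_) fun e => ?_
  · simp [LinearMap.add_apply, weight_tgt_longVec, weight_src_longVec, cornerCoord_longVec]
  · cases e with
    | hex r =>
      simp only [LinearMap.add_apply, weight_src_hex, weight_tgt_hex, cornerCoord_hex]
      split_ifs <;> grind
    | dig r hr =>
      simp only [LinearMap.add_apply, weight_src_dig, weight_tgt_dig, cornerCoord_dig]
      have : r ≠ s := by rintro rfl; exact hr h
      rw [h]
      simp [this]

/-- The two sides of an interior edge give the same value to the sum of the corner coordinates at
the ends of the side, up to weights. -/
theorem cornerCoord_add_next (s : Side F) :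
    T.weight (src s) - T.weight (tgt s) + (T.cornerCoord s + T.cornerCoord (next s)) =
      T.weight (src (T.glue s)) - T.weight (tgt (T.glue s)) +
        (T.cornerCoord (T.glue s) + T.cornerCoord (next (T.glue s))) := by
  refine lattice_hom_ext (fun t => ?_) fun e => ?_
  · simp [LinearMap.add_apply, weight_tgt_longVec, weight_src_longVec, cornerCoord_longVec]
  · cases e with
    | hex r =>
      simp only [LinearMap.add_apply, LinearMap.sub_apply, weight_src_hex, weight_tgt_hex,
        cornerCoord_hex]
      split_ifs <;> grind
    | dig r hr =>
      simp only [LinearMap.add_apply, LinearMap.sub_apply, weight_src_dig, weight_tgt_dig,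
        cornerCoord_dig]
      split_ifs <;> grind [T.glue_glue s]

/-! ### Balanced exponents -/

variable (T) in
/-- An exponent is balanced if its weights vanish at all fencing vertices except possibly at the
distinguished fencing vertices of the marked points, which are the end points of the boundary
sides. -/
def Balanced : Submodule ℤ T.Lattice where
  carrier := {x | (∀ s, T.weight (src s) x = 0) ∧ ∀ s, T.glue s ≠ s → T.weight (tgt s) x = 0}
  zero_mem' := by simp
  add_mem' {x y} hx hy :=
    ⟨fun s => by rw [map_add, hx.1, hy.1, add_zero],
      fun s hs => by rw [map_add, hx.2 s hs, hy.2 s hs, add_zero]⟩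
  smul_mem' n x hx :=
    ⟨fun s => by rw [map_smul, hx.1, smul_zero], fun s hs => by rw [map_smul, hx.2 s hs, smul_zero]⟩

theorem Balanced.cornerCoord_add_next {x : T.Lattice} (hx : x ∈ T.Balanced) (s : Side F) :
    T.cornerCoord s x + T.cornerCoord (next s) x =
      T.cornerCoord (T.glue s) x + T.cornerCoord (next (T.glue s)) x := by
  by_cases h : T.glue s = s
  · rw [h]
  · have h' : T.glue (T.glue s) ≠ T.glue s := by rw [T.glue_glue]; exact Ne.symm h
    have := LinearMap.congr_fun (T.cornerCoord_add_next s) x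
    simpa [hx.1, hx.2 _ h, hx.2 _ h'] using this

open Classical in
theorem mk_eq_sum [Fintype F] (f : T.Gen →₀ ℤ) :
    (Submodule.Quotient.mk f : T.Lattice) =
      ∑ s, (f (.long s) • T.longVec s + f (.short (.hex s)) • T.shortVec (.hex s) +
        (if h : T.glue s = s then 0 else f (.short (.dig s h))) • T.digVec s) := by
  induction f using Finsupp.induction_linear with
  | zero => simp
  | add f g hf hg =>
    rw [Submodule.Quotient.mk_add, hf, hg, ← Finset.sum_add_distrib]
    refine Finset.sum_congr rfl fun s _ => ?_
    split_ifs <;> simp only [Finsupp.add_apply, add_smul, zero_smul] <;> abel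
  | single g n =>
    have hn : (Submodule.Quotient.mk (Finsupp.single g n) : T.Lattice) =
        n • Submodule.Quotient.mk (Finsupp.single g 1) := by
      rw [← Submodule.Quotient.mk_smul, Finsupp.smul_single, smul_eq_mul, mul_one]
    rw [hn]
    rcases g with t | (t | ⟨t, ht⟩)
    · rw [Finset.sum_eq_single t]
      · simp [longVec]
      · intro s _ hs
        simp [Ne.symm hs]
      · simp
    · rw [Finset.sum_eq_single t]
      · simp [shortVec]
      · intro s _ hs
        simp [Ne.symm hs]
      · simp
    · rw [Finset.sum_eq_single t]
      · rw [digVec_of_ne ht]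
        simp [shortVec, ht]
      · intro s _ hs
        simp [Ne.symm hs]
      · simp

/-- A balanced exponent is determined by its corner coordinates. -/
theorem Balanced.eq_zero [Fintype F] {x : T.Lattice} (hx : x ∈ T.Balanced)
    (h : ∀ s, T.cornerCoord s x = 0) : x = 0 := by
  classical
  obtain ⟨f, rfl⟩ := Submodule.Quotient.mk_surjective _ x
  have hf := mk_eq_sum f
  set X : Side F → ℤ := fun s => f (.long s) with hX
  set Y : Side F → ℤ := fun s => if h : T.glue s = s then 0 else f (.short (.dig s h)) with hY
  have hc : ∀ s, f (.short (.hex s)) = 0 := by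
    intro s
    have := h s
    rw [hf] at this
    simp only [map_sum, map_add, map_smul, cornerCoord_longVec, cornerCoord_hex,
      cornerCoord_digVec, smul_zero, zero_add, add_zero] at this
    simpa using this
  have hf' : (Submodule.Quotient.mk f : T.Lattice) =
      ∑ s, (X s • T.longVec s + Y s • T.digVec s) := by
    rw [hf]
    simp [hc, hX, hY]
  have hsrc : ∀ s, X s + Y s = 0 := by
    intro s
    have := hx.1 s
    rw [hf'] at this
    simp only [map_sum, map_add, map_smul, weight_src_longVec, weight_src_digVec,
      Finset.sum_add_distrib] at this
    by_cases hs : T.glue s = s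
    · simpa [hs, hY] using this
    · simpa [hs] using this
  have htgt : ∀ s, T.glue s ≠ s → X s = Y (T.glue s) := by
    intro s hs
    have := hx.2 s hs
    rw [hf'] at this
    simp only [map_sum, map_add, map_smul, weight_tgt_longVec, weight_tgt_digVec hs,
      Finset.sum_add_distrib] at this
    simp at this
    linarith
  rw [hf']
  -- the summands of the two sides of a rectangle cancel
  refine Finset.sum_involution (fun s _ => T.glue s) ?_ ?_ (fun _ _ => Finset.mem_univ _)
    (fun s _ => T.glue_glue s)
  · intro s _
    by_cases hs : T.glue s = s
    · have : X s = 0 := by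
        have := hsrc s
        simpa [hY, hs] using this
      rw [hs, digVec_of_eq hs, this]
      simp
    · have h1 := hsrc s
      have h2 := hsrc (T.glue s)
      have h3 := htgt s hs
      have e := T.digVec_add_longVec s
      have e1 : Y s = -X s := by linarith
      have e2 : Y (T.glue s) = X s := h3.symm
      have e3 : X (T.glue s) = -X s := by linarith
      rw [e1, e2, e3]
      have e' : T.longVec s - T.digVec s + T.digVec (T.glue s) - T.longVec (T.glue s) = 0 := by
        have e'' := sub_eq_zero.2 e.symm
        rw [← e'']
        abel
      calc _ = X s • (T.longVec s - T.digVec s + T.digVec (T.glue s) - T.longVec (T.glue s)) := by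
            module
        _ = 0 := by rw [e', smul_zero]
  · intro s _ hne hs
    apply hne
    have : X s = 0 := by
      have := hsrc s
      simpa [hY, hs] using this
    rw [digVec_of_eq hs, this]
    simp

/-- For balanced exponents, pairing with a side is given by the corner coordinates. -/
theorem form_longVec_balanced {x : T.Lattice} (hx : x ∈ T.Balanced) (s : Side F) :
    T.form (T.longVec s) x =
      T.weight (tgt s) x - 2 * (T.cornerCoord s x + T.cornerCoord (next s) x) := by
  rw [form_longVec]
  simp [hx.1, mul_add]

theorem form_hex_balanced {x : T.Lattice} (hx : x ∈ T.Balanced) (s : Side F) :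
    T.form (T.shortVec (.hex s)) x = T.weight (tgt (prev s)) x := by
  rw [form_shortVec]
  simp [ShortEdge.head, ShortEdge.tail, hx.1]

theorem form_digVec_balanced {x : T.Lattice} (hx : x ∈ T.Balanced) (s : Side F) :
    T.form (T.digVec s) x = 0 := by
  by_cases h : T.glue s = s
  · rw [digVec_of_eq h, map_zero, LinearMap.zero_apply]
  · have h' : T.glue (T.glue s) ≠ T.glue s := by rw [T.glue_glue]; exact Ne.symm h
    rw [digVec_of_ne h, form_shortVec]
    simp [ShortEdge.head, ShortEdge.tail, hx.1, hx.2 _ h']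

/-! ### The product of the short edges around a vertex -/

open Classical in
theorem alphaVec_eq [Fintype F] (r : T.Region) :
    T.alphaVec r =
      ∑ s, if T.region (src s) = r then T.shortVec (.hex s) + T.digVec s else 0 := by
  have h1 : T.alphaVec r = ∑ s : Side F, ((if T.region (tgt s) = r then T.outVec (tgt s) else 0) +
      if T.region (src s) = r then T.outVec (src s) else 0) := by
    rw [alphaVec, Fintype.sum_prod_type]
    simp [src, tgt]
  rw [h1, Finset.sum_add_distrib]
  have h2 : ∑ s : Side F, (if T.region (tgt s) = r then T.outVec (tgt s) else 0) =
      ∑ s : Side F, if T.region (src s) = r then T.shortVec (.hex s) else 0 := by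
    refine Fintype.sum_equiv ⟨next, prev, prev_next, next_prev⟩ _ _ fun s => ?_
    rw [region_tgt, outVec_tgt]
    rfl
  rw [h2, ← Finset.sum_add_distrib]
  refine Finset.sum_congr rfl fun s _ => ?_
  split_ifs <;> simp

open Classical in
theorem cornerCoord_alphaVec [Fintype F] (s : Side F) (r : T.Region) :
    T.cornerCoord s (T.alphaVec r) = if T.region (src s) = r then 1 else 0 := by
  rw [alphaVec_eq, map_sum, Finset.sum_eq_single s]
  · split_ifs <;> simp [cornerCoord_hex, cornerCoord_digVec]
  · intro t _ ht
    split_ifs <;> simp [cornerCoord_hex, cornerCoord_digVec, ht]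
  · simp

open Classical in
theorem weight_src_alphaVec [Fintype F] (s : Side F) (r : T.Region) :
    T.weight (src s) (T.alphaVec r) =
      if T.glue s = s ∧ T.region (src s) = r then -1 else 0 := by
  rw [alphaVec_eq, map_sum, Finset.sum_eq_single s]
  · by_cases h : T.glue s = s <;> split_ifs <;>
      simp_all [weight_src_hex, weight_src_digVec]
  · intro t _ ht
    split_ifs <;> simp [weight_src_hex, weight_src_digVec, ht]
  · simp

theorem weight_tgt_alphaVec [Fintype F] {s : Side F} (hs : T.glue s ≠ s) (r : T.Region) :
    T.weight (tgt s) (T.alphaVec r) = 0 := by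
  classical
  rw [alphaVec_eq, map_sum]
  have : ∀ t, T.weight (tgt s) (if T.region (src t) = r then T.shortVec (.hex t) + T.digVec t
      else 0) = (if t = next s then if T.region (src t) = r then 1 else 0 else 0) -
        if t = T.glue s then if T.region (src t) = r then 1 else 0 else 0 := by
    intro t
    split_ifs <;> simp_all [weight_tgt_hex, weight_tgt_digVec hs]
  simp only [this, Finset.sum_sub_distrib, Finset.sum_ite_eq', Finset.mem_univ, if_true]
  rw [← region_tgt, ← region_tgt_of_glue_ne hs, sub_self]

theorem alphaVec_mem_balanced [Fintype F] {r : T.Region} (h : ¬ T.IsMarked r) :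
    T.alphaVec r ∈ T.Balanced := by
  classical
  refine ⟨fun s => ?_, fun s hs => weight_tgt_alphaVec hs r⟩
  rw [weight_src_alphaVec, if_neg]
  rintro ⟨hs, rfl⟩
  exact h (isMarked_src hs)

open Classical in
theorem form_alphaVec_balanced [Fintype F] {x : T.Lattice} (hx : x ∈ T.Balanced)
    (r : T.Region) :
    T.form (T.alphaVec r) x = ∑ s, if T.region (tgt s) = r then T.weight (tgt s) x else 0 := by
  rw [alphaVec_eq, map_sum, LinearMap.sum_apply]
  symm
  refine Fintype.sum_equiv ⟨next, prev, prev_next, next_prev⟩ _ _ fun s => ?_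
  rw [region_tgt]
  change _ = T.form (if T.region (src (next s)) = r then _ else 0) x
  split_ifs
  · rw [map_add, LinearMap.add_apply]
    rw [Equiv.coe_fn_mk, form_hex_balanced hx, form_digVec_balanced hx, prev_next, add_zero]
  · simp

theorem form_alphaVec_of_not_isMarked [Fintype F] {x : T.Lattice} (hx : x ∈ T.Balanced)
    {r : T.Region} (h : ¬ T.IsMarked r) : T.form (T.alphaVec r) x = 0 := by
  classical
  rw [form_alphaVec_balanced hx]
  refine Finset.sum_eq_zero fun s _ => ?_
  split_ifs with hs
  · refine hx.2 s fun hs' => h (hs ▸ isMarked_tgt hs')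
  · rfl

theorem form_alphaVec_tgt [Fintype F] (N : T.Notching) {x : T.Lattice} (hx : x ∈ T.Balanced)
    {s : Side F} (h : T.glue s = s) :
    T.form (T.alphaVec (T.region (tgt s))) x =
      T.cornerCoord s x + T.cornerCoord (next s) x := by
  classical
  rw [form_alphaVec_balanced hx, Finset.sum_eq_single s]
  · rw [if_pos rfl, weight_tgt_of_glue_eq h]
    simp [hx.1]
  · intro t _ ht
    split_ifs with h'
    · exact hx.2 t fun ht' => ht (N.eq_of_region_tgt_eq ht' h h')
    · rfl
  · simp

namespace Notching

variable (N : T.Notching)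

/-! ### The exponents of the images of the cluster variables -/

open Classical in
/-- The value of `V` at the region of the corner where `s` starts if that corner is the
distinguished angle of a puncture, and zero otherwise. -/
def notchAt {M : Type*} [Zero M] (V : T.Region → M) (s : Side F) : M :=
  if src s = N.base (T.region (src s)) then V (T.region (src s)) else 0

/-- The signed contribution of the distinguished angles in the triangle of `s`: those at the ends
of `s` count positively, the one opposite to `s` counts negatively. -/
def notchTerm {M : Type*} [AddCommGroup M] (V : T.Region → M) (s : Side F) : M :=
  N.notchAt V s + N.notchAt V (next s) - N.notchAt V (prev s)

theorem not_isMarked_of_eq_base {s : Side F} (h : src s = N.base (T.region (src s))) :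
    ¬ T.IsMarked (T.region (src s)) := by
  intro hm
  obtain ⟨t, -, ht⟩ := N.base_marked _ hm
  rw [ht] at h
  simp at h

theorem map_notchAt {M M' : Type*} [AddCommGroup M] [AddCommGroup M'] (f : M →ₗ[ℤ] M')
    (V : T.Region → M) (s : Side F) : f (N.notchAt V s) = N.notchAt (fun r => f (V r)) s := by
  unfold notchAt
  split_ifs
  · rfl
  · exact map_zero f

theorem map_notchTerm {M M' : Type*} [AddCommGroup M] [AddCommGroup M'] (f : M →ₗ[ℤ] M')
    (V : T.Region → M) (s : Side F) :
    f (N.notchTerm V s) = N.notchTerm (fun r => f (V r)) s := by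
  simp only [notchTerm, map_sub, map_add, map_notchAt]

theorem notchAt_mem {M : Type*} [AddCommGroup M] {W : Submodule ℤ M} {V : T.Region → M}
    (h : ∀ r, ¬ T.IsMarked r → V r ∈ W) (s : Side F) : N.notchAt V s ∈ W := by
  unfold notchAt
  split_ifs with hs
  · exact h _ (N.not_isMarked_of_eq_base hs)
  · exact W.zero_mem

theorem notchTerm_mem {M : Type*} [AddCommGroup M] {W : Submodule ℤ M} {V : T.Region → M}
    (h : ∀ r, ¬ T.IsMarked r → V r ∈ W) (s : Side F) : N.notchTerm V s ∈ W :=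
  W.sub_mem (W.add_mem (N.notchAt_mem h _) (N.notchAt_mem h _)) (N.notchAt_mem h _)

theorem notchTerm_eq_zero {M : Type*} [AddCommGroup M] {V : T.Region → M}
    (h : ∀ r, ¬ T.IsMarked r → V r = 0) (s : Side F) : N.notchTerm V s = 0 :=
  (Submodule.mem_bot ℤ).1 (N.notchTerm_mem (fun r hr => (Submodule.mem_bot ℤ).2 (h r hr)) s)

open Classical in
theorem notchAt_eq_sum [Fintype F] {M : Type*} [AddCommGroup M] (V : T.Region → M) (s : Side F) :
    N.notchAt V s = ∑ p : T.Puncture, if N.base p.1 = src s then V p.1 else 0 := by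
  unfold notchAt
  split_ifs with h
  · symm
    refine (Finset.sum_eq_single (⟨T.region (src s), N.not_isMarked_of_eq_base h⟩ : T.Puncture)
      ?_ ?_).trans (if_pos h.symm)
    · intro p _ hp
      refine if_neg fun hb => hp (Subtype.ext ?_)
      rw [← N.region_base p.1, hb]
    · exact fun h' => absurd (Finset.mem_univ (α := T.Puncture) _) h'
  · symm
    refine Finset.sum_eq_zero fun p _ => if_neg fun hb => h ?_
    rw [← hb, N.region_base]

variable (T) in
/-- The contribution of a side to the Weyl-ordered product `Z_{s₁⁻} Z_{s₁⁺}⁻¹ Z_{s₂⁻} Z_{s₂⁺}⁻¹`,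
as far as it does not depend on the notching. -/
def halfVec (u : Side F) : T.Lattice :=
  T.longVec (prev u) - T.longVec (next u) + T.shortVec (.hex (prev u)) -
    T.shortVec (.hex (next u)) - T.shortVec (.hex u) - T.digVec u

variable (T) in
open Classical in
/-- The additional contribution of a boundary side. -/
def boundaryVec [Fintype F] (u : Side F) : T.Lattice :=
  if T.glue u = u then T.longVec u + (2 : ℤ) • T.alphaVec (T.region (src u)) else 0

/-- The contribution of a side to the exponent `edgeVec`. -/
def sideVec [Fintype F] (u : Side F) : T.Lattice :=
  halfVec T u + (2 : ℤ) • N.notchTerm T.alphaVec u + boundaryVec T u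

open Classical in
/-- The sum of the contributions of the sides of an edge.  For an edge that is not the internal
edge of a self-folded triangle this is the exponent of the image of its cluster variable. -/
def edgeVec [Fintype F] (e : T.Edge) : T.Lattice :=
  ∑ u, if T.edge u = e then N.sideVec u else 0

theorem basePath_src_eq [Fintype F] (s : Side F) :
    N.basePath (src s) =
      N.basePath (tgt (prev s)) + T.shortVec (.hex s) - N.notchAt T.alphaVec s := by
  rw [N.basePath_src, outVec_tgt, next_prev]
  rfl

theorem zVec_prev_sub_zVec_next [Fintype F] (u : Side F) :
    N.zVec (prev u) - N.zVec (next u) =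
      halfVec T u + N.notchTerm T.alphaVec u + T.digVec u +
        N.basePath (src u) - N.basePath (tgt u) := by
  have h1 := N.basePath_src_eq (T := T) (prev u)
  have h2 := N.basePath_src_eq (T := T) (next u)
  have h3 := N.basePath_src_eq (T := T) u
  rw [prev_prev] at h1
  rw [prev_next] at h2
  have e : ∀ s, N.zVec s = T.longVec s + N.basePath (src s) + N.basePath (tgt s) := fun _ => rfl
  rw [e, e, h1, h2, h3, halfVec, notchTerm]
  abel

theorem not_isInner_outer (s : Side F) : ¬ T.IsInner (T.outer s) := by
  have h1 := T.glue_glue s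
  have h2 := next_prev s
  have h3 := prev_next s
  have h4 := next_next s
  have h5 := prev_prev s
  have h6 := next_ne s
  have h7 := prev_ne s
  have h8 := next_ne (next s)
  have h9 := T.glue_glue (prev s)
  have h10 := T.glue_glue (next s)
  unfold IsInner outer
  split_ifs <;> grind

theorem outer_of_not_isInner {s : Side F} (h : ¬ T.IsInner s) : T.outer s = s := by
  unfold IsInner at h
  push Not at h
  simp [outer, h.1, h.2]

open Classical in
theorem xTildeVec_eq [Fintype F] (s : Side F) :
    N.xTildeVec s = ∑ u, if T.edge u = T.edge (T.outer s) then
      halfVec T u + N.notchTerm T.alphaVec u + boundaryVec T u else 0 := by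
  rw [sum_edge, xTildeVec]
  generalize T.outer s = o
  have h1 := N.zVec_prev_sub_zVec_next o
  have h2 := N.zVec_prev_sub_zVec_next (T.glue o)
  split_ifs with h
  · rw [boundaryVec, if_pos h, add_sub_assoc, h1, zVec, digVec_of_eq h,
      ← N.basePath_src_of_glue_eq h]
    change T.longVec o + N.basePath (src o) + N.basePath (tgt o) + _ = _
    module
  · have h' : T.glue (T.glue o) ≠ T.glue o := by rw [T.glue_glue]; exact Ne.symm h
    rw [boundaryVec, boundaryVec, if_neg h, if_neg h']
    have h3 := N.basePath_tgt_glue h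
    have h4 := N.basePath_tgt_glue h'
    rw [T.glue_glue] at h4
    calc _ = (N.zVec (prev o) - N.zVec (next o)) +
          (N.zVec (prev (T.glue o)) - N.zVec (next (T.glue o))) := by abel
      _ = _ := by
        rw [h1, h2, h3, h4]
        abel

open Classical in
theorem notchExp_eq [Fintype F] {s b : Side F} (hs : ¬ T.IsInner s) {p : T.Puncture}
    (hb : N.base p.1 = src b) :
    N.notchExp p s = ∑ u, if T.edge u = T.edge s then
      ((if b = u then 1 else 0) + (if b = next u then 1 else 0) - if b = prev u then 1 else 0)
      else 0 := by
  rw [sum_edge, notchExp, hb]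
  unfold IsInner at hs
  simp only [edge_eq_iff]
  have h1 := T.glue_glue s
  have h1' := T.glue_glue b
  have h2 := next_prev b
  have h3 := prev_next b
  have h4 := next_next b
  have h5 := prev_prev b
  have h6 := next_ne b
  have h7 := prev_ne b
  have g1 := T.glue_glue (prev b)
  have g2 := T.glue_glue (next b)
  have i2 := next_prev s
  have i3 := prev_next s
  have j2 := next_prev (T.glue s)
  have j3 := prev_next (T.glue s)
  split_ifs <;> grind

theorem sum_notchExp [Fintype F] {s : Side F} (hs : ¬ T.IsInner s) :
    ∑ p : T.Puncture, N.notchExp p s • T.alphaVec p.1 =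
      ∑ u, open Classical in if T.edge u = T.edge s then N.notchTerm T.alphaVec u else 0 := by
  classical
  have : ∀ p : T.Puncture, N.notchExp p s • T.alphaVec p.1 =
      ∑ u, if T.edge u = T.edge s then
        ((if N.base p.1 = src u then T.alphaVec p.1 else 0) +
          (if N.base p.1 = src (next u) then T.alphaVec p.1 else 0) -
          if N.base p.1 = src (prev u) then T.alphaVec p.1 else 0) else 0 := by
    intro p
    obtain ⟨b, hb⟩ := N.base_puncture p.1 p.2
    rw [N.notchExp_eq hs hb, hb, Finset.sum_smul]
    refine Finset.sum_congr rfl fun u _ => ?_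
    simp only [Prod.mk.injEq, and_true]
    split_ifs <;> module
  rw [Finset.sum_congr rfl fun p _ => this p, Finset.sum_comm]
  refine Finset.sum_congr rfl fun u _ => ?_
  split_ifs
  · rw [notchTerm, notchAt_eq_sum, notchAt_eq_sum, notchAt_eq_sum, Finset.sum_sub_distrib,
      Finset.sum_add_distrib]
  · simp

/-- The puncture in a self-folded triangle has exactly two fencing vertices. -/
theorem region_eq_of_self_folded {s : Side F} (h : T.glue s = next s) (w : Vertex F) :
    T.region w = T.region (tgt s) ↔ w = tgt s ∨ w = src (next s) := by
  constructor
  · intro hw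
    refine (iff_of_region_eq (P := fun w => w = tgt s ∨ w = src (next s)) (fun e => ?_) hw).2
      (Or.inl rfl)
    cases e with
    | hex r =>
      have h1 := next_prev r
      have h2 := prev_next s
      simp only [ShortEdge.tail, ShortEdge.head, Prod.mk.injEq]
      grind
    | dig r hr =>
      have h1 := T.glue_glue r
      have h2 := T.glue_glue s
      simp only [ShortEdge.tail, ShortEdge.head, Prod.mk.injEq]
      grind
  · rintro (rfl | rfl)
    · rfl
    · exact (region_tgt s).symm

theorem not_isMarked_of_self_folded {s : Side F} (h : T.glue s = next s) :
    ¬ T.IsMarked (T.region (tgt s)) := by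
  rintro ⟨w, hw, hw'⟩
  have h1 := next_ne s
  have h2 := T.glue_glue s
  rcases (region_eq_of_self_folded h w).1 hw' with rfl | rfl <;> simp at hw <;> grind

theorem edgeVec_of_glue_eq_next [Fintype F] {s : Side F} (h : T.glue s = next s) :
    N.edgeVec (T.edge s) = (2 : ℤ) • T.alphaVec (T.region (tgt s)) := by
  classical
  have hne : T.glue s ≠ s := by rw [h]; exact next_ne s
  have hne' : T.glue (next s) ≠ next s := by
    rw [← h, T.glue_glue]; exact Ne.symm hne
  have hbase : src (next s) = N.base (T.region (src (next s))) := by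
    obtain ⟨b, hb⟩ := N.base_puncture _ (not_isMarked_of_self_folded h)
    have hr := N.region_base (T.region (tgt s))
    rw [region_eq_of_self_folded h] at hr
    rw [← region_tgt]
    rcases hr with hr | hr
    · rw [hb] at hr
      simp at hr
    · exact hr.symm
  have hα : T.alphaVec (T.region (tgt s)) = T.shortVec (.hex (next s)) + T.digVec (next s) := by
    rw [alphaVec_eq, Finset.sum_eq_single (next s)]
    · rw [if_pos (region_tgt s).symm]
    · intro t _ ht
      refine if_neg fun h' => ?_
      rw [region_eq_of_self_folded h] at h'
      rcases h' with h' | h'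
      · simp at h'
      · exact ht (by simpa using h')
    · simp
  have hrel := T.digVec_add_longVec s
  rw [h] at hrel
  have hk : N.notchAt T.alphaVec (next s) = T.alphaVec (T.region (tgt s)) := by
    rw [notchAt, if_pos hbase, region_tgt]
  rw [edgeVec, sum_edge, if_neg hne, h, sideVec, sideVec, boundaryVec, boundaryVec, if_neg hne,
    if_neg hne', notchTerm, notchTerm, next_next, prev_next, hk, hα, halfVec, halfVec, next_next,
    prev_next]
  have hrel' : T.longVec s = T.longVec (next s) + T.digVec s - T.digVec (next s) := by
    rw [eq_sub_iff_add_eq, add_comm, ← hrel, add_comm]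
  rw [hrel']
  module

open Classical in
theorem edgeVec_of_isInner [Fintype F] {s : Side F} (h : T.IsInner s) :
    N.edgeVec (T.edge s) = (2 : ℤ) • T.alphaVec (T.innerRegion s) := by
  by_cases h1 : T.glue s = next s
  · rw [innerRegion, if_pos h1, N.edgeVec_of_glue_eq_next h1]
  · have h2 : T.glue s = prev s := h.resolve_left h1
    have h3 : T.glue (prev s) = next (prev s) := by rw [next_prev, ← h2, T.glue_glue]
    rw [innerRegion, if_neg h1, region_src, ← N.edgeVec_of_glue_eq_next h3, ← h2, edge_glue]

theorem not_isMarked_innerRegion {s : Side F} (h : T.IsInner s) :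
    ¬ T.IsMarked (T.innerRegion s) := by
  by_cases h1 : T.glue s = next s
  · rw [innerRegion, if_pos h1]
    exact not_isMarked_of_self_folded h1
  · have h2 : T.glue s = prev s := h.resolve_left h1
    have h3 : T.glue (prev s) = next (prev s) := by rw [next_prev, ← h2, T.glue_glue]
    rw [innerRegion, if_neg h1, region_src]
    exact not_isMarked_of_self_folded h3

open Classical in
/-- The exponent of the image of a cluster variable in terms of the exponents `edgeVec`. -/
theorem xTildeVec_add_alphaEdgeVec [Fintype F] (s : Side F) :
    N.xTildeVec s + N.alphaEdgeVec s =
      N.edgeVec (T.edge (T.outer s)) + if T.IsInner s then N.edgeVec (T.edge s) else 0 := by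
  have h : N.edgeVec (T.edge (T.outer s)) = N.xTildeVec s +
      ∑ p : T.Puncture, N.notchExp p (T.outer s) • T.alphaVec p.1 := by
    rw [N.sum_notchExp (not_isInner_outer s), xTildeVec_eq, edgeVec, ← Finset.sum_add_distrib]
    refine Finset.sum_congr rfl fun u _ => ?_
    split_ifs
    · rw [sideVec]
      module
    · simp
  rw [h, alphaEdgeVec, add_assoc]
  split_ifs with hs
  · rw [N.edgeVec_of_isInner hs]
  · simp

end Notching

/-! ### The lattice of `PGL₂` -/

theorem sum_zmod_three {M : Type*} [AddCommMonoid M] (g : ZMod 3 → M) (i : ZMod 3) :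
    ∑ j, g j = g i + g (i + 1) + g (i - 1) := by
  have : (Finset.univ : Finset (ZMod 3)) = {i, i + 1, i - 1} := by revert i; decide
  rw [this, Finset.sum_insert, Finset.sum_pair, add_assoc]
  · revert i; decide
  · revert i; decide

theorem hexagonVec_eq (s : Side F) :
    T.hexagonVec s.1 = T.longVec s + T.longVec (next s) + T.longVec (prev s) +
      (T.shortVec (.hex s) + T.shortVec (.hex (next s)) + T.shortVec (.hex (prev s))) := by
  obtain ⟨f, i⟩ := s
  rw [hexagonVec, sum_zmod_three _ i]
  simp only [next, prev]
  abel

variable (T) in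
/-- The exponents of the generators of `fencingPGL2`. -/
def pglGenerators : Set T.Lattice :=
  {x | ∃ (s : Side F) (n : ℤ), (n = 2 ∨ n = -2) ∧ x = n • T.longVec s} ∪
    {x | ∃ (e : T.ShortEdge) (n : ℤ), (n = 2 ∨ n = -2) ∧ x = n • T.shortVec e} ∪
    {x | ∃ (f : F) (n : ℤ), (n = 1 ∨ n = -1) ∧ x = n • T.hexagonVec f}

variable (T) in
/-- The lattice of the exponents of the monomials in `fencingPGL2`. -/
def pglLattice : AddSubgroup T.Lattice := AddSubgroup.closure T.pglGenerators

theorem two_smul_mem_pglLattice (x : T.Lattice) : (2 : ℤ) • x ∈ T.pglLattice := by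
  have h : (AddSubgroup.toIntSubmodule T.pglLattice).mkQ.comp
      ((2 : ℤ) • (LinearMap.id : T.Lattice →ₗ[ℤ] T.Lattice)) = 0 := by
    refine lattice_hom_ext (fun s => ?_) fun e => ?_
    · exact (Submodule.Quotient.mk_eq_zero _).2
        (AddSubgroup.subset_closure (Or.inl (Or.inl ⟨s, 2, Or.inl rfl, rfl⟩)))
    · exact (Submodule.Quotient.mk_eq_zero _).2
        (AddSubgroup.subset_closure (Or.inl (Or.inr ⟨e, 2, Or.inl rfl, rfl⟩)))
  exact (Submodule.Quotient.mk_eq_zero _).1 (LinearMap.congr_fun h x)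

theorem hexagonVec_mem_pglLattice (f : F) : T.hexagonVec f ∈ T.pglLattice :=
  AddSubgroup.subset_closure (Or.inr ⟨f, 1, Or.inl rfl, (one_smul ℤ _).symm⟩)

theorem neg_mem_pglGenerators {x : T.Lattice} (hx : x ∈ T.pglGenerators) :
    -x ∈ T.pglGenerators := by
  rcases hx with (⟨s, n, hn, rfl⟩ | ⟨e, n, hn, rfl⟩) | ⟨f, n, hn, rfl⟩
  · exact Or.inl (Or.inl ⟨s, -n, by omega, (neg_smul _ _).symm⟩)
  · exact Or.inl (Or.inr ⟨e, -n, by omega, (neg_smul _ _).symm⟩)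
  · exact Or.inr ⟨f, -n, by omega, (neg_smul _ _).symm⟩

/-- For the exponents in the lattice of `PGL₂`, all corner coordinates of a triangle have the same
parity. -/
theorem even_cornerCoord_add_next {x : T.Lattice} (hx : x ∈ T.pglLattice) (s : Side F) :
    Even (T.cornerCoord s x + T.cornerCoord (next s) x) := by
  classical
  induction hx using AddSubgroup.closure_induction with
  | mem x hx =>
    rcases hx with (⟨t, n, hn, rfl⟩ | ⟨e, n, hn, rfl⟩) | ⟨f, n, hn, rfl⟩
    · simp [cornerCoord_longVec]
    · have : Even n := by rcases hn with rfl | rfl <;> decide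
      rw [map_smul, map_smul, ← smul_add]
      exact this.mul_right _
    · have h : ∀ t : Side F,
          T.cornerCoord t (T.hexagonVec f) = if t.1 = f then 1 else 0 := by
        rintro ⟨g, i⟩
        rw [hexagonVec, map_sum]
        simp only [map_add, cornerCoord_longVec, cornerCoord_hex, zero_add, Prod.mk.injEq]
        split_ifs with hg
        · have hg' : g = f := hg
          subst hg'
          simp
        · have hg' : ¬ f = g := fun h => hg h.symm
          simp [hg']
      rw [map_smul, map_smul, h, h, ← smul_add]
      change Even (n • ((if s.1 = f then (1 : ℤ) else 0) + if s.1 = f then 1 else 0))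
      refine Even.mul_left ?_ n
      exact ⟨_, rfl⟩
  | zero => simp
  | add x y _ _ hx hy =>
    rw [map_add, map_add, add_add_add_comm]
    exact hx.add hy
  | neg x _ hx =>
    rw [map_neg, map_neg, ← neg_add]
    exact hx.neg

namespace Notching

variable (N : T.Notching)

theorem mem_pglLattice_of_eq {x y : T.Lattice} (hy : y ∈ T.pglLattice) (z : T.Lattice)
    (h : x = y + (2 : ℤ) • z) : x ∈ T.pglLattice :=
  h ▸ T.pglLattice.add_mem hy (two_smul_mem_pglLattice z)

theorem edgeVec_mem_pglLattice [Fintype F] (e : T.Edge) : N.edgeVec e ∈ T.pglLattice := by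
  classical
  obtain ⟨s, rfl⟩ := exists_edge_eq e
  rw [edgeVec, sum_edge]
  split_ifs with h
  · refine mem_pglLattice_of_eq (hexagonVec_mem_pglLattice s.1)
      (N.notchTerm T.alphaVec s + T.alphaVec (T.region (src s)) - T.longVec (next s) -
        T.shortVec (.hex (next s)) - T.shortVec (.hex s)) ?_
    rw [sideVec, halfVec, boundaryVec, if_pos h, digVec_of_eq h, hexagonVec_eq]
    module
  · have h' : T.glue (T.glue s) ≠ T.glue s := by rw [T.glue_glue]; exact Ne.symm h
    refine mem_pglLattice_of_eq
      (T.pglLattice.add_mem (hexagonVec_mem_pglLattice s.1)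
        (hexagonVec_mem_pglLattice (T.glue s).1))
      (N.notchTerm T.alphaVec s - T.longVec (next s) -
        T.shortVec (.hex (next s)) - T.shortVec (.hex s) +
        (N.notchTerm T.alphaVec (T.glue s) - T.longVec (next (T.glue s)) -
        T.shortVec (.hex (next (T.glue s))) - T.shortVec (.hex (T.glue s))) -
        T.digVec (T.glue s) - T.longVec s) ?_
    have e : T.digVec s = T.digVec (T.glue s) + T.longVec s - T.longVec (T.glue s) := by
      rw [← T.digVec_add_longVec, add_sub_cancel_right]
    rw [sideVec, sideVec, halfVec, halfVec, boundaryVec, boundaryVec, if_neg h, if_neg h', e,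
      hexagonVec_eq, hexagonVec_eq]
    module

theorem notchTerm_alphaVec_mem_balanced [Fintype F] (u : Side F) :
    N.notchTerm T.alphaVec u ∈ T.Balanced :=
  N.notchTerm_mem (fun _ hr => alphaVec_mem_balanced hr) u

theorem weight_src_sideVec [Fintype F] (t u : Side F) : T.weight (src t) (N.sideVec u) = 0 := by
  classical
  have h1 := (N.notchTerm_alphaVec_mem_balanced u).1 t
  have h2 : T.glue u = u → T.glue t = t → T.region (src t) = T.region (src u) → t = u :=
    fun hu ht => N.eq_of_region_src_eq ht hu
  rw [sideVec, map_add, map_add, map_smul, h1, smul_zero, add_zero, halfVec, boundaryVec]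
  split_ifs with hu
  · simp only [map_add, map_sub, map_smul, weight_src_longVec, weight_src_hex, weight_src_digVec,
      weight_src_alphaVec, smul_eq_mul]
    by_cases ht : u = t
    · subst ht
      simp only [hu]
      split_ifs <;> grind
    · have : ¬ (T.glue t = t ∧ T.region (src t) = T.region (src u)) :=
        fun h => ht (h2 hu h.1 h.2).symm
      simp only [this, ht]
      split_ifs <;> grind
  · simp only [map_add, map_sub, map_zero, weight_src_longVec, weight_src_hex, weight_src_digVec]
    split_ifs <;> grind

open Classical in
theorem weight_tgt_sideVec [Fintype F] {t : Side F} (ht : T.glue t ≠ t) (u : Side F) :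
    T.weight (tgt t) (N.sideVec u) = (if u = T.glue t then 1 else 0) - if u = t then 1 else 0 := by
  have h1 := (N.notchTerm_alphaVec_mem_balanced u).2 t ht
  have h2 := next_prev u
  have h3 := prev_next u
  have h4 := next_next t
  have h5 := prev_next t
  have h6 := next_prev t
  have h7 := prev_prev u
  have h8 := next_next u
  have hb : T.weight (tgt t) (boundaryVec T u) = 0 := by
    rw [boundaryVec]
    split_ifs with hu
    · have : u ≠ t := by rintro rfl; exact ht hu
      simp [weight_tgt_longVec, weight_tgt_alphaVec ht, this]
    · simp
  rw [sideVec, map_add, map_add, map_smul, h1, smul_zero, add_zero, hb, add_zero, halfVec]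
  simp only [map_add, map_sub, weight_tgt_longVec, weight_tgt_hex, weight_tgt_digVec ht]
  split_ifs <;> grind

theorem edgeVec_mem_balanced [Fintype F] (e : T.Edge) : N.edgeVec e ∈ T.Balanced := by
  classical
  refine ⟨fun t => ?_, fun t ht => ?_⟩
  · rw [edgeVec, map_sum]
    refine Finset.sum_eq_zero fun u _ => ?_
    split_ifs
    · exact N.weight_src_sideVec t u
    · exact map_zero _
  · have : ∀ u, T.weight (tgt t) (if T.edge u = e then N.sideVec u else 0) =
        (if u = T.glue t then if T.edge u = e then 1 else 0 else 0) -
          if u = t then if T.edge u = e then 1 else 0 else 0 := by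
      intro u
      by_cases h : T.edge u = e
      · simp only [h, if_true, N.weight_tgt_sideVec ht]
      · simp [h]
    rw [edgeVec, map_sum, Finset.sum_congr rfl fun u _ => this u]
    simp [edge_glue]

/-! ### Edge coordinates -/

variable (T) in
open Classical in
/-- The number of the ends of an edge in a region. -/
def endCount (r : T.Region) : T.Edge → ℤ :=
  Quot.lift (fun s => (if T.region (src s) = r then 1 else 0) +
    if T.region (tgt s) = r then 1 else 0) (by
    rintro s t rfl
    by_cases h : T.glue s = s
    · rw [h]
    · rw [region_src_of_glue_ne h, region_tgt_of_glue_ne h, add_comm])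

open Classical in
theorem endCount_edge (r : T.Region) (s : Side F) :
    endCount T r (T.edge s) = (if T.region (src s) = r then 1 else 0) +
      if T.region (tgt s) = r then 1 else 0 := rfl

variable (T) in
/-- The corner coordinate at the start of a side that belongs to given edge coordinates.  Twice
the edge coordinate is the sum of the two corner coordinates along a side. -/
def cornerOf (t : Side F) : (T.Edge → ℤ) →ₗ[ℤ] ℤ :=
  let coord : Side F → (T.Edge → ℤ) →ₗ[ℤ] ℤ := fun s => LinearMap.proj (T.edge s)
  coord t + coord (prev t) - coord (next t)

theorem cornerOf_apply (t : Side F) (n : T.Edge → ℤ) :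
    cornerOf T t n = n (T.edge t) + n (T.edge (prev t)) - n (T.edge (next t)) := rfl

theorem cornerOf_add_next (t : Side F) (n : T.Edge → ℤ) :
    cornerOf T t n + cornerOf T (next t) n = 2 * n (T.edge t) := by
  rw [cornerOf_apply, cornerOf_apply, prev_next, next_next]
  ring

open Classical in
theorem cornerOf_endCount (t : Side F) (r : T.Region) :
    cornerOf T t (endCount T r) = 2 * if T.region (src t) = r then 1 else 0 := by
  rw [cornerOf_apply, endCount_edge, endCount_edge, endCount_edge, region_tgt (prev t), next_prev,
    region_tgt (next t), next_next, region_tgt t]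
  ring

open Classical in
/-- The edge coordinates of the exponent `edgeVec`. -/
def edgeImage [Fintype F] (e : T.Edge) : T.Edge → ℤ :=
  -Pi.single e 1 + ∑ u, if T.edge u = e then
    N.notchTerm (endCount T) u + (if T.glue u = u then endCount T (T.region (src u)) else 0) else 0

theorem cornerCoord_notchTerm [Fintype F] (t u : Side F) :
    2 * T.cornerCoord t (N.notchTerm T.alphaVec u) =
      cornerOf T t (N.notchTerm (endCount T) u) := by
  change ((2 : ℤ) • T.cornerCoord t) _ = _
  rw [map_notchTerm, map_notchTerm]
  congr 1
  funext r
  rw [cornerOf_endCount, LinearMap.smul_apply, cornerCoord_alphaVec, smul_eq_mul]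

open Classical in
theorem cornerCoord_sideVec [Fintype F] (t u : Side F) :
    T.cornerCoord t (N.sideVec u) =
      -(if u = t then 1 else 0) - (if u = prev t then 1 else 0) + (if u = next t then 1 else 0) +
        (cornerOf T t (N.notchTerm (endCount T) u) +
          cornerOf T t (if T.glue u = u then endCount T (T.region (src u)) else 0)) := by
  have h2 := next_prev u
  have h3 := prev_next u
  have h5 := prev_next t
  have h6 := next_prev t
  have hb : T.cornerCoord t (boundaryVec T u) =
      cornerOf T t (if T.glue u = u then endCount T (T.region (src u)) else 0) := by
    rw [boundaryVec]
    split_ifs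
    · rw [map_add, map_smul, cornerCoord_longVec, cornerCoord_alphaVec, cornerOf_endCount,
        zero_add, smul_eq_mul]
    · rw [map_zero, map_zero]
  rw [sideVec, map_add, map_add, map_smul, smul_eq_mul, cornerCoord_notchTerm, hb, halfVec,
    ← add_assoc]
  congr 2
  simp only [map_add, map_sub, cornerCoord_longVec, cornerCoord_hex, cornerCoord_digVec]
  split_ifs <;> grind

theorem cornerCoord_edgeVec [Fintype F] (e : T.Edge) (t : Side F) :
    T.cornerCoord t (N.edgeVec e) = cornerOf T t (N.edgeImage e) := by
  classical
  rw [edgeVec, edgeImage, map_add, map_neg, map_sum, map_sum, ← sub_eq_zero, sub_add_eq_sub_sub,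
    sub_neg_eq_add, add_sub_right_comm, ← Finset.sum_sub_distrib]
  have : ∀ u, T.cornerCoord t (if T.edge u = e then N.sideVec u else 0) -
      cornerOf T t (if T.edge u = e then N.notchTerm (endCount T) u +
        (if T.glue u = u then endCount T (T.region (src u)) else 0) else 0) =
      -(if u = t then if T.edge u = e then 1 else 0 else 0) -
        (if u = prev t then if T.edge u = e then 1 else 0 else 0) +
        if u = next t then if T.edge u = e then 1 else 0 else 0 := by
    intro u
    by_cases h0 : T.edge u = e
    · simp only [h0, if_true, N.cornerCoord_sideVec, map_add]
      ring
    · simp only [h0, if_false, map_zero, ite_self]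
      ring
  rw [Finset.sum_congr rfl fun u _ => this u]
  simp [Finset.sum_add_distrib, cornerOf_apply, Pi.single_apply]

end Notching

instance [Finite F] : Finite T.Edge := inferInstanceAs (Finite (Quot _))

instance [Finite F] : Fintype T.Edge := Fintype.ofFinite _

namespace Notching

variable (N : T.Notching)

/-! ### The edge coordinates span -/

theorem endCount_eq_zero {r : T.Region} (hr : ¬ T.IsMarked r) {s : Side F} (hs : T.glue s = s) :
    endCount T r (T.edge s) = 0 := by
  classical
  have h1 : T.region (src s) ≠ r := fun h => hr (h ▸ isMarked_src hs)
  have h2 : T.region (tgt s) ≠ r := fun h => hr (h ▸ isMarked_tgt hs)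
  simp [endCount_edge, h1, h2]

open Classical in
/-- Pairing the distinguished angles with the ends of the edges in a region counts every
distinguished angle of that region twice. -/
theorem sum_endCount_smul_notchTerm [Fintype F] {M : Type*} [AddCommGroup M] (V : T.Region → M)
    (r : T.Region) :
    ∑ u, endCount T r (T.edge u) • N.notchTerm V u =
      if T.IsMarked r then 0 else (2 : ℤ) • V r := by
  have h1 : ∑ u, endCount T r (T.edge u) • N.notchAt V (next u) =
      ∑ u, endCount T r (T.edge (prev u)) • N.notchAt V u :=
    Fintype.sum_equiv ⟨next, prev, prev_next, next_prev⟩ _ _ fun u => by simp [prev_next]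
  have h2 : ∑ u, endCount T r (T.edge u) • N.notchAt V (prev u) =
      ∑ u, endCount T r (T.edge (next u)) • N.notchAt V u :=
    Fintype.sum_equiv ⟨prev, next, next_prev, prev_next⟩ _ _ fun u => by simp [next_prev]
  have h3 : ∑ u, endCount T r (T.edge u) • N.notchTerm V u =
      ∑ u, cornerOf T u (endCount T r) • N.notchAt V u := by
    simp only [notchTerm, smul_sub, smul_add, Finset.sum_sub_distrib, Finset.sum_add_distrib,
      cornerOf_apply, sub_smul, add_smul, h1, h2]
  rw [h3]
  split_ifs with hr
  · refine Finset.sum_eq_zero fun u _ => ?_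
    rw [cornerOf_endCount, notchAt]
    split_ifs with h h'
    · exact absurd (h ▸ hr) (N.not_isMarked_of_eq_base h')
    all_goals simp
  · obtain ⟨b, hb⟩ := N.base_puncture r hr
    have hbr : T.region (src b) = r := by rw [← hb, N.region_base]
    rw [Finset.sum_eq_single b]
    · rw [cornerOf_endCount, notchAt, hbr, hb, if_pos rfl, if_pos rfl, mul_one]
    · intro u _ hu
      rw [cornerOf_endCount, notchAt]
      split_ifs with h h'
      · rw [h, hb] at h'
        exact absurd (by simpa using h') hu
      all_goals simp
    · simp

open Classical in
theorem sum_endCount_smul_edgeImage [Fintype F] (r : T.Region) :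
    ∑ e, endCount T r e • N.edgeImage e =
      -endCount T r + (if T.IsMarked r then 0 else (2 : ℤ) • endCount T r) +
        ∑ u, if T.glue u = u then
          endCount T r (T.edge u) • endCount T (T.region (src u)) else 0 := by
  have h1 : ∑ e, endCount T r e • (-Pi.single e 1 : T.Edge → ℤ) = -endCount T r := by
    ext e
    simp [Pi.single_apply]
  have h2 : ∀ g : Side F → T.Edge → ℤ,
      ∑ e, endCount T r e • (∑ u, if T.edge u = e then g u else 0) =
        ∑ u, endCount T r (T.edge u) • g u := by
    intro g
    simp only [Finset.smul_sum, smul_ite, smul_zero]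
    rw [Finset.sum_comm]
    refine Finset.sum_congr rfl fun u _ => ?_
    simp
  simp only [edgeImage, smul_add, Finset.sum_add_distrib]
  rw [h1, h2]
  simp only [smul_add, Finset.sum_add_distrib, N.sum_endCount_smul_notchTerm, smul_ite, smul_zero]
  rw [add_assoc]

theorem endCount_mem_span_of_not_isMarked [Fintype F] {r : T.Region} (hr : ¬ T.IsMarked r) :
    endCount T r ∈ Submodule.span ℤ (Set.range N.edgeImage) := by
  classical
  have h : ∑ e, endCount T r e • N.edgeImage e = endCount T r := by
    rw [N.sum_endCount_smul_edgeImage, if_neg hr, Finset.sum_eq_zero]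
    · module
    · intro u _
      split_ifs with hu
      · rw [endCount_eq_zero hr hu, zero_smul]
      · rfl
  rw [← h]
  exact Submodule.sum_mem _ fun e _ =>
    Submodule.smul_mem _ _ (Submodule.subset_span ⟨e, rfl⟩)

theorem endCount_mem_span_of_glue_eq [Fintype F] {s : Side F} (hs : T.glue s = s) :
    endCount T (T.region (src s)) ∈ Submodule.span ℤ (Set.range N.edgeImage) := by
  classical
  -- the marked point at the other end of `s`
  set r := T.region (tgt s) with hr
  have hm : T.IsMarked r := isMarked_tgt hs
  obtain ⟨t, ht, htr⟩ := N.exists_src_of_isMarked hm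
  have h : ∑ e, endCount T r e • N.edgeImage e = endCount T (T.region (src s)) := by
    have h1 : ∀ u, (if T.glue u = u then
        endCount T r (T.edge u) • endCount T (T.region (src u)) else 0) =
        (if u = t then endCount T (T.region (src u)) else 0) +
          if u = s then endCount T (T.region (src u)) else 0 := by
      intro u
      have e1 : T.glue u = u → (T.region (src u) = r ↔ u = t) := fun hu =>
        ⟨fun h => N.eq_of_region_src_eq hu ht (h.trans htr.symm), fun h => h ▸ htr⟩
      have e2 : T.glue u = u → (T.region (tgt u) = r ↔ u = s) := fun hu =>
        ⟨fun h => N.eq_of_region_tgt_eq hu hs h, fun h => h ▸ hr.symm⟩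
      by_cases hu : T.glue u = u
      · simp only [hu, if_true, endCount_edge, e1 hu, e2 hu, add_smul, ite_smul, one_smul,
          zero_smul]
      · have n1 : u ≠ t := by rintro rfl; exact hu ht
        have n2 : u ≠ s := by rintro rfl; exact hu hs
        simp [hu, n1, n2]
    rw [N.sum_endCount_smul_edgeImage, if_pos hm, Finset.sum_congr rfl fun u _ => h1 u,
      Finset.sum_add_distrib, Finset.sum_ite_eq', Finset.sum_ite_eq', if_pos (Finset.mem_univ _),
      if_pos (Finset.mem_univ _), htr]
    abel
  rw [← h]
  exact Submodule.sum_mem _ fun e _ =>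
    Submodule.smul_mem _ _ (Submodule.subset_span ⟨e, rfl⟩)

theorem span_edgeImage [Fintype F] : Submodule.span ℤ (Set.range N.edgeImage) = ⊤ := by
  classical
  set W := Submodule.span ℤ (Set.range N.edgeImage) with hW
  have hsingle : ∀ e : T.Edge, (Pi.single e 1 : T.Edge → ℤ) ∈ W := by
    intro e
    have h1 : N.edgeImage e ∈ W := Submodule.subset_span ⟨e, rfl⟩
    rw [edgeImage] at h1
    rw [← W.neg_mem_iff]
    refine (W.add_mem_iff_left (Submodule.sum_mem _ fun u _ => ?_)).1 h1
    split_ifs with h2 h3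
    · exact W.add_mem (N.notchTerm_mem (fun r hr => N.endCount_mem_span_of_not_isMarked hr) u)
        (N.endCount_mem_span_of_glue_eq h3)
    · exact W.add_mem (N.notchTerm_mem (fun r hr => N.endCount_mem_span_of_not_isMarked hr) u)
        W.zero_mem
    · exact W.zero_mem
  refine (Submodule.eq_top_iff').2 fun n => ?_
  have : n = ∑ e, n e • (Pi.single e 1 : T.Edge → ℤ) := by
    ext e
    simp [Pi.single_apply]
  rw [this]
  exact Submodule.sum_mem _ fun e _ => Submodule.smul_mem _ _ (hsingle e)

/-! ### Self-folded triangles -/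

open Classical in
/-- Replaces the value at the internal edge of a self-folded triangle by the sum of the values at
the internal and at the outer edge. -/
def addOuter {M : Type*} [AddCommGroup M] (f : T.Edge → M) (e : T.Edge) : M :=
  f (T.outerEdge e) + if T.outerEdge e = e then 0 else f e

theorem outerEdge_edge (s : Side F) : T.outerEdge (T.edge s) = T.edge (T.outer s) := rfl

theorem outerEdge_outerEdge (e : T.Edge) : T.outerEdge (T.outerEdge e) = T.outerEdge e := by
  obtain ⟨s, rfl⟩ := exists_edge_eq e
  rw [outerEdge_edge, outerEdge_edge, outer_of_not_isInner (not_isInner_outer s)]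

theorem outerEdge_eq_iff (s : Side F) : T.outerEdge (T.edge s) = T.edge s ↔ ¬ T.IsInner s := by
  constructor
  · intro h hs
    rw [outerEdge_edge, edge_eq_iff] at h
    have h0 := not_isInner_outer (T := T) s
    rcases h with h | h
    · rw [h] at h0
      exact h0 hs
    · rw [h] at h0
      apply h0
      have h1 := T.glue_glue s
      have h2 := next_prev s
      have h3 := prev_next s
      unfold IsInner at hs ⊢
      grind
  · intro h
    rw [outerEdge_edge, outer_of_not_isInner h]

theorem map_addOuter {M M' : Type*} [AddCommGroup M] [AddCommGroup M'] (g : M →ₗ[ℤ] M')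
    (f : T.Edge → M) (e : T.Edge) : g (addOuter f e) = addOuter (fun e => g (f e)) e := by
  unfold addOuter
  split_ifs <;> simp

theorem span_addOuter {M : Type*} [AddCommGroup M] (f : T.Edge → M) :
    Submodule.span ℤ (Set.range (addOuter f)) = Submodule.span ℤ (Set.range f) := by
  classical
  apply le_antisymm
  · rw [Submodule.span_le]
    rintro _ ⟨e, rfl⟩
    have h : ∀ e, f e ∈ Submodule.span ℤ (Set.range f) := fun e => Submodule.subset_span ⟨e, rfl⟩
    rw [addOuter]
    split_ifs
    · exact Submodule.add_mem _ (h _) (Submodule.zero_mem _)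
    · exact Submodule.add_mem _ (h _) (h _)
  · rw [Submodule.span_le]
    rintro _ ⟨e, rfl⟩
    have h : ∀ e, addOuter f e ∈ Submodule.span ℤ (Set.range (addOuter f)) :=
      fun e => Submodule.subset_span ⟨e, rfl⟩
    have h1 := h (T.outerEdge e)
    rw [addOuter, if_pos (outerEdge_outerEdge _), outerEdge_outerEdge, add_zero] at h1
    have h2 := h e
    rw [addOuter] at h2
    split_ifs at h2 with he
    · rwa [he] at h1
    · exact (Submodule.add_mem_iff_right _ h1).1 h2

/-- The exponent of the image of a cluster variable. -/
def clusterVec [Fintype F] : T.Edge → T.Lattice := addOuter N.edgeVec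

theorem clusterVec_edge [Fintype F] (s : Side F) :
    N.clusterVec (T.edge s) = N.xTildeVec s + N.alphaEdgeVec s := by
  classical
  rw [xTildeVec_add_alphaEdgeVec, clusterVec, addOuter, outerEdge_edge, ← outerEdge_edge]
  congr 1
  by_cases h : T.IsInner s
  · rw [if_pos h, if_neg]
    rw [outerEdge_eq_iff]
    exact fun h' => h' h
  · rw [if_neg h, if_pos ((outerEdge_eq_iff s).2 h)]

theorem clusterVec_mem_balanced [Fintype F] (e : T.Edge) : N.clusterVec e ∈ T.Balanced := by
  classical
  rw [clusterVec, addOuter]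
  split_ifs
  · exact T.Balanced.add_mem (N.edgeVec_mem_balanced _) T.Balanced.zero_mem
  · exact T.Balanced.add_mem (N.edgeVec_mem_balanced _) (N.edgeVec_mem_balanced _)

/-! ### The isomorphism of lattices -/

/-- The linear map of exponents that underlies the homomorphism of quantum tori. -/
def clusterMap [Fintype F] : (T.Edge →₀ ℤ) →ₗ[ℤ] T.Lattice :=
  Finsupp.linearCombination ℤ N.clusterVec

theorem clusterMap_single [Fintype F] (e : T.Edge) :
    N.clusterMap (Finsupp.single e 1) = N.clusterVec e := by
  simp [clusterMap]

theorem clusterMap_mem_balanced [Fintype F] (k : T.Edge →₀ ℤ) : N.clusterMap k ∈ T.Balanced := by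
  rw [clusterMap, Finsupp.linearCombination_apply]
  exact Submodule.sum_mem _ fun e _ => Submodule.smul_mem _ _ (N.clusterVec_mem_balanced e)

theorem clusterMap_mem_pglLattice [Fintype F] (k : T.Edge →₀ ℤ) :
    N.clusterMap k ∈ T.pglLattice := by
  classical
  rw [clusterMap, Finsupp.linearCombination_apply]
  refine AddSubgroup.sum_mem _ fun e _ => T.pglLattice.zsmul_mem ?_ _
  rw [clusterVec, addOuter]
  split_ifs
  · exact T.pglLattice.add_mem (N.edgeVec_mem_pglLattice _) T.pglLattice.zero_mem
  · exact T.pglLattice.add_mem (N.edgeVec_mem_pglLattice _) (N.edgeVec_mem_pglLattice _)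

theorem cornerCoord_clusterMap [Fintype F] (k : T.Edge →₀ ℤ) (t : Side F) :
    T.cornerCoord t (N.clusterMap k) =
      cornerOf T t (Finsupp.linearCombination ℤ (addOuter N.edgeImage) k) := by
  rw [clusterMap, Finsupp.linearCombination_apply, Finsupp.linearCombination_apply, map_finsuppSum,
    map_finsuppSum]
  refine Finsupp.sum_congr fun e _ => ?_
  rw [map_smul, map_smul, clusterVec, map_addOuter, map_addOuter]
  simp only [cornerCoord_edgeVec]

theorem addOuter_edgeImage_surjective [Fintype F] :
    Function.Surjective (Finsupp.linearCombination ℤ (addOuter N.edgeImage)) := by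
  rw [← LinearMap.range_eq_top, Finsupp.range_linearCombination, span_addOuter, span_edgeImage]

theorem clusterMap_injective [Fintype F] : Function.Injective N.clusterMap := by
  rw [← LinearMap.ker_eq_bot, LinearMap.ker_eq_bot']
  intro k hk
  have hn : Finsupp.linearCombination ℤ (addOuter N.edgeImage) k = 0 := by
    ext e
    obtain ⟨s, rfl⟩ := exists_edge_eq e
    have h := cornerOf_add_next (T := T) s (Finsupp.linearCombination ℤ (addOuter N.edgeImage) k)
    rw [← cornerCoord_clusterMap, ← cornerCoord_clusterMap, hk, map_zero, map_zero] at h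
    rw [Pi.zero_apply]
    linarith
  -- a surjective endomorphism of a finitely generated free module is injective
  let g : (T.Edge →₀ ℤ) →ₗ[ℤ] (T.Edge →₀ ℤ) :=
    (Finsupp.linearEquivFunOnFinite ℤ ℤ T.Edge).symm.toLinearMap.comp
      (Finsupp.linearCombination ℤ (addOuter N.edgeImage))
  have hg : Function.Surjective g :=
    (Finsupp.linearEquivFunOnFinite ℤ ℤ T.Edge).symm.surjective.comp
      N.addOuter_edgeImage_surjective
  have hg' := OrzechProperty.injective_of_surjective_endomorphism g hg
  apply hg'
  rw [map_zero, LinearMap.comp_apply, hn, map_zero]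

/-- Every exponent of `PGL₂` that is balanced is the exponent of a cluster monomial. -/
theorem exists_clusterMap_eq [Fintype F] {x : T.Lattice} (h1 : x ∈ T.Balanced)
    (h2 : x ∈ T.pglLattice) : ∃ k, N.clusterMap k = x := by
  -- the edge coordinates of `x`
  let n : T.Edge → ℤ := Quot.lift
    (fun s => (T.cornerCoord s x + T.cornerCoord (next s) x) / 2) (by
      rintro s t rfl
      rw [Balanced.cornerCoord_add_next h1 s])
  have hn : ∀ s, 2 * n (T.edge s) = T.cornerCoord s x + T.cornerCoord (next s) x := fun s =>
    Int.mul_ediv_cancel' (even_cornerCoord_add_next h2 s).two_dvd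
  obtain ⟨k, hk⟩ := N.addOuter_edgeImage_surjective n
  refine ⟨k, sub_eq_zero.1 (Balanced.eq_zero
    (T.Balanced.sub_mem (N.clusterMap_mem_balanced k) h1) fun s => ?_)⟩
  have e1 := hn s
  have e2 := hn (prev s)
  have e3 := hn (next s)
  rw [next_prev] at e2
  rw [next_next] at e3
  rw [map_sub, cornerCoord_clusterMap, hk, cornerOf_apply]
  linarith

/-! ### The form on the image -/

theorem form_halfVec {x : T.Lattice} (hx : x ∈ T.Balanced) (u : Side F) :
    T.form (halfVec T u) x =
      2 * (T.cornerCoord (next u) x + T.cornerCoord (prev u) x) -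
        2 * (T.cornerCoord (prev u) x + T.cornerCoord u x) - T.weight (tgt u) x := by
  simp only [halfVec, map_sub, map_add, LinearMap.sub_apply, LinearMap.add_apply,
    form_longVec_balanced hx, form_hex_balanced hx, form_digVec_balanced hx, prev_prev, prev_next,
    next_prev, next_next]
  ring

theorem form_notchTerm [Fintype F] {x : T.Lattice} (hx : x ∈ T.Balanced) (u : Side F) :
    T.form (N.notchTerm T.alphaVec u) x = 0 := by
  change (T.form.flip x) (N.notchTerm T.alphaVec u) = 0
  rw [map_notchTerm]
  exact N.notchTerm_eq_zero (fun r hr => form_alphaVec_of_not_isMarked hx hr) u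

theorem form_sideVec_of_glue_ne [Fintype F] {x : T.Lattice} (hx : x ∈ T.Balanced) {u : Side F}
    (hu : T.glue u ≠ u) :
    T.form (N.sideVec u) x =
      2 * (T.cornerCoord (next u) x + T.cornerCoord (prev u) x) -
        2 * (T.cornerCoord (prev u) x + T.cornerCoord u x) := by
  rw [sideVec, boundaryVec, if_neg hu, add_zero, map_add, map_smul, LinearMap.add_apply,
    LinearMap.smul_apply, N.form_notchTerm hx, form_halfVec hx, hx.2 u hu]
  simp

/-- For a boundary side `u`, the boundary side `t` that ends where `u` starts contributes. -/
theorem form_sideVec_of_glue_eq [Fintype F] {x : T.Lattice} (hx : x ∈ T.Balanced) {u t : Side F}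
    (hu : T.glue u = u) (ht : T.glue t = t) (htu : T.region (tgt t) = T.region (src u)) :
    T.form (N.sideVec u) x =
      2 * (T.cornerCoord (next u) x + T.cornerCoord (prev u) x) -
        2 * (T.cornerCoord (prev u) x + T.cornerCoord u x) +
        2 * (T.cornerCoord t x + T.cornerCoord (next t) x) -
        2 * (T.cornerCoord u x + T.cornerCoord (next u) x) := by
  rw [sideVec, boundaryVec, if_pos hu, ← htu, map_add, map_add, map_add, map_smul, map_smul,
    LinearMap.add_apply, LinearMap.add_apply, LinearMap.add_apply, LinearMap.smul_apply,
    LinearMap.smul_apply, N.form_notchTerm hx, form_halfVec hx, form_longVec_balanced hx,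
    form_alphaVec_tgt N hx ht]
  simp only [smul_eq_mul]
  ring

theorem cornerCoord_edgeVec_add_next [Fintype F] (e : T.Edge) (s : Side F) :
    T.cornerCoord s (N.edgeVec e) + T.cornerCoord (next s) (N.edgeVec e) =
      2 * N.edgeImage e (T.edge s) := by
  rw [cornerCoord_edgeVec, cornerCoord_edgeVec, cornerOf_add_next]

theorem cornerCoord_edgeVec_next_add_prev [Fintype F] (e : T.Edge) (s : Side F) :
    T.cornerCoord (next s) (N.edgeVec e) + T.cornerCoord (prev s) (N.edgeVec e) =
      2 * N.edgeImage e (T.edge (next s)) := by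
  rw [← cornerCoord_edgeVec_add_next, next_next]

theorem cornerCoord_edgeVec_prev_add [Fintype F] (e : T.Edge) (s : Side F) :
    T.cornerCoord (prev s) (N.edgeVec e) + T.cornerCoord s (N.edgeVec e) =
      2 * N.edgeImage e (T.edge (prev s)) := by
  rw [← cornerCoord_edgeVec_add_next, next_prev]

open Classical in
/-- A linear functional that vanishes on the end counts of the punctures only sees the leading
terms of the edge coordinates and the contributions of the boundary sides. -/
theorem apply_edgeImage [Fintype F] (g : (T.Edge → ℤ) →ₗ[ℤ] ℤ)
    (hg : ∀ r, ¬ T.IsMarked r → g (endCount T r) = 0) (e : T.Edge) :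
    g (N.edgeImage e) = -g (Pi.single e 1) +
      ∑ u, if T.edge u = e ∧ T.glue u = u then g (endCount T (T.region (src u))) else 0 := by
  rw [edgeImage, map_add, map_neg, map_sum]
  congr 1
  refine Finset.sum_congr rfl fun u _ => ?_
  by_cases h1 : T.edge u = e
  · by_cases h2 : T.glue u = u
    · simp only [h1, h2, and_self, if_true, map_add, map_notchTerm, N.notchTerm_eq_zero hg,
        zero_add]
    · simp only [h1, h2, and_false, if_true, if_false, map_notchTerm,
        N.notchTerm_eq_zero hg, add_zero]
  · simp [h1]

open Classical in
theorem form_edgeVec [Fintype F] (e e' : T.Edge) :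
    T.form (N.edgeVec e) (N.edgeVec e') =
      4 * ∑ u, if T.edge u = e then
        ((if T.edge (prev u) = e' then 1 else 0) - if T.edge (next u) = e' then 1 else 0)
        else 0 := by
  obtain ⟨s, rfl⟩ := exists_edge_eq e
  have hx := N.edgeVec_mem_balanced e'
  let c : Side F → (T.Edge → ℤ) →ₗ[ℤ] ℤ := fun u => LinearMap.proj (T.edge u)
  have hc : ∀ u n, c u n = n (T.edge u) := fun _ _ => rfl
  -- the next and the previous side of `u` share the vertex opposite to `u`, which cancels
  have hend : ∀ u r, endCount T r (T.edge (next u)) - endCount T r (T.edge (prev u)) =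
      (if T.region (tgt u) = r then 1 else 0) - if T.region (src u) = r then 1 else 0 := by
    intro u r
    rw [endCount_edge, endCount_edge, ← region_tgt u, region_tgt (next u), next_next,
      region_tgt (prev u), next_prev]
    ring
  rw [sum_edge]
  conv_lhs => rw [edgeVec, sum_edge]
  by_cases hs : T.glue s = s
  · obtain ⟨t, ht, hts⟩ := N.exists_tgt_of_isMarked (isMarked_src hs)
    rw [if_pos hs, if_pos hs, add_zero, add_zero, N.form_sideVec_of_glue_eq hx hs ht hts,
      cornerCoord_edgeVec_add_next, cornerCoord_edgeVec_add_next,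
      cornerCoord_edgeVec_next_add_prev, cornerCoord_edgeVec_prev_add]
    have hcount : ∀ r, (c (next s) - c (prev s) + c t - c s) (endCount T r) =
        (if T.region (src t) = r then 1 else 0) - if T.region (src s) = r then 1 else 0 := by
      intro r
      have := hend s r
      simp only [LinearMap.sub_apply, LinearMap.add_apply, hc]
      rw [this, endCount_edge, endCount_edge, hts]
      ring
    have hg := N.apply_edgeImage (c (next s) - c (prev s) + c t - c s) (fun r hr => by
      have h1 : T.region (src t) ≠ r := fun h => hr (h ▸ isMarked_src ht)
      have h2 : T.region (src s) ≠ r := fun h => hr (h ▸ isMarked_src hs)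
      rw [hcount, if_neg h1, if_neg h2, sub_zero]) e'
    have hsum : (∑ u, if T.edge u = e' ∧ T.glue u = u then
        (c (next s) - c (prev s) + c t - c s) (endCount T (T.region (src u))) else 0) =
        (if T.edge t = e' then 1 else 0) - if T.edge s = e' then 1 else 0 := by
      have : ∀ u, (if T.edge u = e' ∧ T.glue u = u then
          (c (next s) - c (prev s) + c t - c s) (endCount T (T.region (src u))) else 0) =
          (if u = t then if T.edge u = e' then 1 else 0 else 0) -
            if u = s then if T.edge u = e' then 1 else 0 else 0 := by
        intro u
        rw [hcount]
        by_cases hu : T.glue u = u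
        · have e1 : T.region (src t) = T.region (src u) ↔ u = t :=
            ⟨fun h => (N.eq_of_region_src_eq ht hu h).symm, fun h => h ▸ rfl⟩
          have e2 : T.region (src s) = T.region (src u) ↔ u = s :=
            ⟨fun h => (N.eq_of_region_src_eq hs hu h).symm, fun h => h ▸ rfl⟩
          simp only [e1, e2, hu, and_true]
          split_ifs <;> simp
        · have n1 : u ≠ t := by rintro rfl; exact hu ht
          have n2 : u ≠ s := by rintro rfl; exact hu hs
          simp [hu, n1, n2]
      rw [Finset.sum_congr rfl fun u _ => this u]
      simp
    rw [hsum] at hg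
    simp only [LinearMap.sub_apply, LinearMap.add_apply, hc, Pi.single_apply] at hg
    linarith
  · have hs' : T.glue (T.glue s) ≠ T.glue s := by rw [T.glue_glue]; exact Ne.symm hs
    rw [if_neg hs, if_neg hs, map_add, LinearMap.add_apply, N.form_sideVec_of_glue_ne hx hs,
      N.form_sideVec_of_glue_ne hx hs', cornerCoord_edgeVec_next_add_prev,
      cornerCoord_edgeVec_prev_add, cornerCoord_edgeVec_next_add_prev,
      cornerCoord_edgeVec_prev_add]
    have hcount : ∀ r, (c (next s) - c (prev s) + (c (next (T.glue s)) - c (prev (T.glue s))))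
        (endCount T r) = 0 := by
      intro r
      have h1 := hend s r
      have h2 := hend (T.glue s) r
      simp only [LinearMap.sub_apply, LinearMap.add_apply, hc]
      rw [h1, h2, region_src_of_glue_ne hs, region_tgt_of_glue_ne hs]
      ring
    have hg := N.apply_edgeImage _ (fun r _ => hcount r) e'
    simp only [hcount, ite_self, Finset.sum_const_zero, add_zero] at hg
    simp only [LinearMap.sub_apply, LinearMap.add_apply, hc, Pi.single_apply] at hg
    linarith

open Classical in
/-- The exchange matrix as a sum over the sides of the first edge.  The contributions of the three
corners of a self-folded triangle cancel, so that the exclusion of these triangles in the definition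
of the exchange matrix has no effect. -/
theorem exchange_eq [Fintype F] (e e' : T.Edge) :
    T.exchange e e' = ∑ u, if T.edge u = T.outerEdge e then
      ((if T.edge (prev u) = T.outerEdge e' then 1 else 0) -
        if T.edge (next u) = T.outerEdge e' then 1 else 0) else 0 := by
  unfold exchange
  generalize T.outerEdge e = a
  generalize T.outerEdge e' = b
  have h1 : (∑ r : Side F, if ∃ i : ZMod 3, T.IsInner (r.1, i) then (0 : ℤ)
      else (if T.edge r = a ∧ T.edge (prev r) = b then 1 else 0) -
        (if T.edge r = b ∧ T.edge (prev r) = a then 1 else 0)) =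
      ∑ r : Side F, ((if T.edge r = a ∧ T.edge (prev r) = b then 1 else 0) -
        (if T.edge r = b ∧ T.edge (prev r) = a then 1 else 0)) := by
    rw [Fintype.sum_prod_type, Fintype.sum_prod_type]
    refine Finset.sum_congr rfl fun f _ => ?_
    by_cases h : ∃ i : ZMod 3, T.IsInner (f, i)
    · simp only [h, if_true]
      obtain ⟨i, hi⟩ := h
      obtain ⟨s, hsf, hs⟩ : ∃ s : Side F, s.1 = f ∧ T.edge (next s) = T.edge s := by
        rcases hi with hi | hi
        · exact ⟨(f, i), rfl, by rw [← hi, edge_glue]⟩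
        · exact ⟨prev (f, i), rfl, by rw [next_prev, ← hi, edge_glue]⟩
      obtain ⟨g, j⟩ := s
      have hg : g = f := hsf
      subst hg
      rw [Finset.sum_const_zero, sum_zmod_three _ j]
      change 0 = ((if T.edge (g, j) = a ∧ T.edge (prev (g, j)) = b then (1 : ℤ) else 0) -
          (if T.edge (g, j) = b ∧ T.edge (prev (g, j)) = a then 1 else 0)) +
        ((if T.edge (next (g, j)) = a ∧ T.edge (prev (next (g, j))) = b then 1 else 0) -
          (if T.edge (next (g, j)) = b ∧ T.edge (prev (next (g, j))) = a then 1 else 0)) +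
        ((if T.edge (prev (g, j)) = a ∧ T.edge (prev (prev (g, j))) = b then 1 else 0) -
          (if T.edge (prev (g, j)) = b ∧ T.edge (prev (prev (g, j))) = a then 1 else 0))
      rw [prev_next, prev_prev, hs]
      split_ifs <;> grind
    · simp only [h, if_false]
  have h2 : (∑ r : Side F, if T.edge r = b ∧ T.edge (prev r) = a then (1 : ℤ) else 0) =
      ∑ r : Side F, if T.edge (next r) = b ∧ T.edge r = a then 1 else 0 :=
    Fintype.sum_equiv ⟨prev, next, next_prev, prev_next⟩ _ _ fun u => by simp [next_prev]
  rw [h1, Finset.sum_sub_distrib, h2, ← Finset.sum_sub_distrib]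
  refine Finset.sum_congr rfl fun u _ => ?_
  split_ifs <;> simp_all

/-- The exponent of the internal edge of a self-folded triangle is a multiple of the exponent of
the product of the short edges around a puncture, which commutes with everything. -/
theorem form_clusterVec_left [Fintype F] (e : T.Edge) {x : T.Lattice} (hx : x ∈ T.Balanced) :
    T.form (N.clusterVec e) x = T.form (N.edgeVec (T.outerEdge e)) x := by
  classical
  obtain ⟨s, rfl⟩ := exists_edge_eq e
  rw [clusterVec, addOuter, map_add, LinearMap.add_apply, add_eq_left]
  split_ifs with h
  · rw [map_zero, LinearMap.zero_apply]
  · rw [outerEdge_eq_iff, not_not] at h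
    rw [N.edgeVec_of_isInner h, map_smul, LinearMap.smul_apply,
      form_alphaVec_of_not_isMarked hx (not_isMarked_innerRegion h), smul_zero]

theorem form_clusterVec [Fintype F] (e e' : T.Edge) :
    T.form (N.clusterVec e) (N.clusterVec e') = 4 * T.exchange e e' := by
  rw [N.form_clusterVec_left e (N.clusterVec_mem_balanced e'), form_swap,
    N.form_clusterVec_left e' (N.edgeVec_mem_balanced _), ← form_swap, form_edgeVec, exchange_eq]

theorem form_clusterMap [Fintype F] (k l : T.Edge →₀ ℤ) :
    T.form (N.clusterMap k) (N.clusterMap l) =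
      QuantumTorus.formOf (fun s t : T.Edge => 4 * T.exchange s t) k l := by
  have h : T.form.compl₁₂ N.clusterMap N.clusterMap =
      QuantumTorus.formOf (fun s t : T.Edge => 4 * T.exchange s t) := by
    refine Finsupp.lhom_ext' fun e => LinearMap.ext_ring (Finsupp.lhom_ext' fun e' =>
      LinearMap.ext_ring ?_)
    change T.form (N.clusterMap (Finsupp.single e 1)) (N.clusterMap (Finsupp.single e' 1)) =
      QuantumTorus.formOf _ (Finsupp.single e 1) (Finsupp.single e' 1)
    rw [QuantumTorus.formOf_single, clusterMap_single, clusterMap_single, form_clusterVec]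
  exact LinearMap.congr_fun (LinearMap.congr_fun h k) l

/-! ### The subalgebras of the fencing graph torus -/

theorem weight_eq_zero_of_mem_balanced [Finite F] {x : T.Lattice} (hx : x ∈ T.Balanced)
    {w : Vertex F} (hw : w ≠ N.base (T.region w) ∨ ¬ T.IsMarked (T.region w)) :
    T.weight w x = 0 := by
  obtain ⟨s, _ | _⟩ := w
  · exact hx.1 s
  · refine hx.2 s fun hs => ?_
    rcases hw with hw | hw
    · exact hw (N.base_eq_tgt hs).symm
    · exact hw (isMarked_tgt hs)

theorem weyl_mem_zetaSL2 [Finite F] {R : Type*} [CommRing R] (v : Rˣ) {x : T.Lattice}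
    (hx : x ∈ T.Balanced) : QuantumTorus.weyl R v T.form x ∈ N.zetaSL2 R v :=
  QuantumTorus.weyl_mem_invariants fun _ hw => N.weight_eq_zero_of_mem_balanced hx (Or.inl hw)

theorem weyl_mem_fencingPGL2 {R : Type*} [CommRing R] (v : Rˣ) {x : T.Lattice}
    (hx : x ∈ T.pglLattice) : QuantumTorus.weyl R v T.form x ∈ T.fencingPGL2 R v := by
  refine QuantumTorus.weyl_mem_of_mem_closure (fun _ => neg_mem_pglGenerators) ?_ hx
  rintro _ ((⟨s, n, hn, rfl⟩ | ⟨e, n, hn, rfl⟩) | ⟨f, n, hn, rfl⟩)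
  · exact Algebra.subset_adjoin (Or.inl (Or.inl ⟨s, n, hn, rfl⟩))
  · exact Algebra.subset_adjoin (Or.inl (Or.inr ⟨e, n, hn, rfl⟩))
  · exact Algebra.subset_adjoin (Or.inr ⟨f, n, hn, rfl⟩)

theorem weyl_mem_chiPGL2 [Finite F] {R : Type*} [CommRing R] (v : Rˣ) {x : T.Lattice}
    (hx : x ∈ T.Balanced) (hx' : x ∈ T.pglLattice) :
    QuantumTorus.weyl R v T.form x ∈ N.chiPGL2 R v :=
  ⟨⟨weyl_mem_fencingPGL2 v hx', N.weyl_mem_zetaSL2 v hx⟩,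
    QuantumTorus.weyl_mem_invariants fun _ hw => N.weight_eq_zero_of_mem_balanced hx (Or.inr hw.1)⟩

theorem mem_pglLattice_of_mem_support {R : Type*} [CommRing R] {v : Rˣ}
    {y : T.FencingTorus R v} (hy : y ∈ T.fencingPGL2 R v) :
    ∀ x ∈ QuantumTorus.support y, x ∈ T.pglLattice := by
  refine QuantumTorus.support_subset_of_mem_adjoin ?_ hy
  rintro _ ((⟨s, n, hn, rfl⟩ | ⟨e, n, hn, rfl⟩) | ⟨f, n, hn, rfl⟩)
  · exact ⟨_, AddSubgroup.subset_closure (Or.inl (Or.inl ⟨s, n, hn, rfl⟩)), rfl⟩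
  · exact ⟨_, AddSubgroup.subset_closure (Or.inl (Or.inr ⟨e, n, hn, rfl⟩)), rfl⟩
  · exact ⟨_, AddSubgroup.subset_closure (Or.inr ⟨f, n, hn, rfl⟩), rfl⟩

theorem mem_balanced_of_mem_support {R : Type*} [CommRing R] {v : Rˣ}
    {y : T.FencingTorus R v} (hy : y ∈ N.chiPGL2 R v) :
    ∀ x ∈ QuantumTorus.support y, x ∈ T.Balanced := by
  intro x hx
  have key : ∀ w : Vertex F, (T.IsMarked (T.region w) → w ≠ N.base (T.region w)) →
      T.weight w x = 0 := by
    intro w hw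
    by_cases h : w = N.base (T.region w)
    · exact hy.2 x hx w ⟨fun hm => hw hm h, h⟩
    · exact hy.1.2 x hx w h
  refine ⟨fun s => key _ fun hm h => N.not_isMarked_of_eq_base h hm, fun s hs => key _ ?_⟩
  intro hm h
  obtain ⟨t, ht, hb⟩ := N.base_marked _ hm
  rw [hb] at h
  have hst : s = t := by simpa using h
  exact hs (hst ▸ ht)

end Notching

end IdealTriangulation

end

theorem mainTheorem9 {R : Type*} [CommRing R] (v : Rˣ) {F : Type*} [Fintype F]
    (T : IdealTriangulation F) (N : T.Notching) :
    ∃ ι : T.XTorus R v →ₐ[R] N.zetaSL2 R v,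
      (∀ s : IdealTriangulation.Side F,
        (ι (T.clusterX R v (T.edge s)) : T.FencingTorus R v) =
          QuantumTorus.weyl R v T.form (N.xTildeVec s + N.alphaEdgeVec s)) ∧
      (∀ ι' : T.XTorus R v →ₐ[R] N.zetaSL2 R v,
        (∀ s : IdealTriangulation.Side F,
          (ι' (T.clusterX R v (T.edge s)) : T.FencingTorus R v) =
            QuantumTorus.weyl R v T.form (N.xTildeVec s + N.alphaEdgeVec s)) → ι' = ι) ∧
      ∃ Φ : T.XTorus R v ≃ₐ[R] N.chiPGL2 R v,
        ∀ x, (Φ x : T.FencingTorus R v) = (ι x : T.FencingTorus R v) := by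
  let f : T.XTorus R v →ₐ[R] T.FencingTorus R v :=
    QuantumTorus.map R v N.clusterMap N.form_clusterMap
  have hf : ∀ k, f (QuantumTorus.weyl R v _ k) = QuantumTorus.weyl R v T.form (N.clusterMap k) :=
    QuantumTorus.map_weyl N.clusterMap N.form_clusterMap
  have hfchi : ∀ x, f x ∈ N.chiPGL2 R v := by
    intro x
    refine QuantumTorus.induction (P := fun x => f x ∈ N.chiPGL2 R v) x ?_ ?_ ?_
    · rw [map_zero]; exact Subalgebra.zero_mem _
    · intro x y hx hy
      rw [map_add]; exact Subalgebra.add_mem _ hx hy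
    · intro c k
      rw [map_smul, hf]
      exact Subalgebra.smul_mem _ (N.weyl_mem_chiPGL2 v (N.clusterMap_mem_balanced k)
        (N.clusterMap_mem_pglLattice k)) c
  have hfX : ∀ s, f (T.clusterX R v (T.edge s)) =
      QuantumTorus.weyl R v T.form (N.xTildeVec s + N.alphaEdgeVec s) := by
    intro s
    rw [IdealTriangulation.clusterX, hf, N.clusterMap_single, N.clusterVec_edge]
  have hbij : Function.Bijective (f.codRestrict (N.chiPGL2 R v) hfchi) := by
    constructor
    · intro x y hxy
      exact QuantumTorus.map_injective _ N.form_clusterMap N.clusterMap_injective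
        (congrArg Subtype.val hxy)
    · rintro ⟨y, hy⟩
      have hy' : y ∈ f.range := by
        refine QuantumTorus.mem_of_support fun x hx => ?_
        obtain ⟨k, rfl⟩ := N.exists_clusterMap_eq (N.mem_balanced_of_mem_support hy x hx)
          (IdealTriangulation.Notching.mem_pglLattice_of_mem_support hy.1.1 x hx)
        exact ⟨_, hf k⟩
      obtain ⟨x, hx⟩ := hy'
      exact ⟨x, Subtype.ext hx⟩
  refine ⟨f.codRestrict (N.zetaSL2 R v) fun x => (hfchi x).1.2, hfX, ?_,
    AlgEquiv.ofBijective _ hbij, fun x => rfl⟩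
  intro ι' hι'
  refine QuantumTorus.algHom_ext (S := Set.range fun e : T.Edge => Finsupp.single e 1) ?_ ?_
  · have h := (Finsupp.basisSingleOne (R := ℤ) (ι := T.Edge)).span_eq
    rw [Finsupp.coe_basisSingleOne] at h
    rw [← Submodule.span_int_eq_addSubgroupClosure, h]
    rfl
  · rintro _ ⟨e, rfl⟩
    obtain ⟨s, rfl⟩ := IdealTriangulation.exists_edge_eq e
    exact Subtype.ext ((hι' s).trans (hfX s).symm)
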